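/- Let $M,n\in\mathbb N$, $\mathcal I=\{1,\dots,M\}$, and let $f_1,\dots,f_M:\mathbb R^n\to\mathbb R^n$ be locally Lipschitz with $f_i(0)=0$, such that for each $i$ and each initial point the equation $\dot x=f_i(x)$ has a unique solution, defined for all $t\in\mathbb R$; write $\Phi_i(t,x)$ for the solution starting at $x$, evaluated at time $t$. Let $\tau_2\ge\tau_1\ge 0$. Consider piecewise constant, right-continuous signals $\sigma:[0,\infty)\to\mathcal I$ (with finitely many discontinuities in each bounded interval), and let $0<t_1^\sigma<t_2^\sigma<\dots$ be the discontinuities of $\sigma$ and $t_0^\sigma=0$. Let $\mathcal S_{\mathrm{dw}}(\tau_1,\tau_2)$ be the set of such signals with infinitely many discontinuities and $\tau_1\le t^\sigma_{k+1}-t^\sigma_k\le\tau_2$ for all $k\ge 0$, and let $\mathcal S^\star_{\mathrm{dw}}(\tau_1,\tau_2)$ be the set of those with infinitely many discontinuities, $\tau_1\le t^\sigma_{k+1}-t^\sigma_k\le\tau_2$ for all $k\ge 1$, and $t_1^\sigma\le\tau_2$ (no lower bound on the first interval). Let $\Phi_\sigma(t,x)$ denote the solution of $\dot x(t)=f_{\sigma(t)}(x(t))$,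 $x(0)=x$. A function $\alpha:[0,\infty)\to\mathbb R$ is of class $\mathcal K$ if it is continuous, strictly increasing and $\alpha(0)=0$, and of class $\mathcal K_\infty$ if moreover it is unbounded; a continuous $\beta:[0,\infty)^2\to[0,\infty)$ is of class $\mathcal{KL}$ if $\beta(\cdot,s)$ is of class $\mathcal K$ for all $s$, and $\beta(r,\cdot)$ is nonincreasing with $\beta(r,s)\to0$ as $s\to\infty$ for all $r$. The switched system is GUAS (globally uniformly asymptotically stable) on a set $\mathcal S$ of signals if there is $\beta\in\mathcal{KL}$ with $|\Phi_\sigma(t,x)|\le\beta(|x|,t)$ for all $\sigma\in\mathcal S$, $x\in\mathbb R^n$, $t\ge0$. Then the switched system is GUAS on $\mathcal S^\star_{\mathrm{dw}}(\tau_1,\tau_2)$, and equivalently on $\mathcal S_{\mathrm{dw}}(\tau_1,\tau_2)$, if and only if there exist $\alpha_1,\alpha_2\in\mathcal K_\infty$ and continuous functions $W_i^-,W_i^+:\mathbb R^n\to\mathbb R$, $i\in\mathcal I$, such that \begin{align*} &\alpha_1(|x|)\le W_i^{*}(x)\le\alpha_2(|x|) && \forall i\in\mathcal I,\ \forall *\in\{-,+\},\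 \forall x\in\mathbb R^n,\\ &W_i^+(\Phi_i(\tau_1,x))\le e^{-\tau_1}W_i^-(x) && \forall i\in\mathcal I,\ \forall x\in\mathbb R^n,\\ &W_j^-(\Phi_i(t,x))\le e^{-t}W_i^+(x) && \forall i\ne j\in\mathcal I,\ \forall t\in[0,\tau_2-\tau_1],\ \forall x\in\mathbb R^n. \end{align*} -/

import Mathlib

open Set Filter Topology

namespace SwitchedSystem

noncomputable section

/-- The state space `ℝⁿ` with its Euclidean norm. -/
abbrev State (n : ℕ) : Type := EuclideanSpace ℝ (Fin n)

/-! ### Comparison functions -/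

/-- Class `𝒦`: continuous on `[0, ∞)`, zero at `0`, strictly increasing on `[0, ∞)`.
Only the values on `[0, ∞)` are relevant. -/
structure ClassK (α : ℝ → ℝ) : Prop where
  continuousOn : ContinuousOn α (Ici 0)
  map_zero : α 0 = 0
  strictMonoOn : StrictMonoOn α (Ici 0)

/-- Class `𝒦_∞`: class `𝒦` and unbounded. -/
structure ClassKInf (α : ℝ → ℝ) : Prop extends ClassK α where
  unbounded : ∀ C : ℝ, ∃ s : ℝ, 0 ≤ s ∧ C < α s

/-- Class `𝒦ℒ`: jointly continuous on `[0, ∞)²`, of class `𝒦` in the first argument, and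
decreasing to `0` in the second argument. -/
structure ClassKL (β : ℝ → ℝ → ℝ) : Prop where
  continuousOn : ContinuousOn (fun p : ℝ × ℝ => β p.1 p.2) (Ici 0 ×ˢ Ici 0)
  classK : ∀ s : ℝ, 0 ≤ s → ClassK (fun r => β r s)
  antitoneOn : ∀ r : ℝ, 0 ≤ r → AntitoneOn (β r) (Ici 0)
  tendsto_zero : ∀ r : ℝ, 0 ≤ r → Tendsto (β r) atTop (𝓝 0)

/-! ### Subsystems and their flows -/

/-- `γ` is a solution of `ẋ = f x`, defined for all (positive and negative) times, that starts
at `x`. -/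
def IsSolution {n : ℕ} (f : State n → State n) (x : State n) (γ : ℝ → State n) : Prop :=
  γ 0 = x ∧ ∀ t : ℝ, HasDerivAt γ (f (γ t)) t

/-- The standing assumption on a vector field: it vanishes at the origin, is locally Lipschitz,
and has, from every initial point, a unique solution, which is defined for all times. -/
structure Regular {n : ℕ} (f : State n → State n) : Prop where
  map_zero : f 0 = 0
  locallyLipschitz : LocallyLipschitz f
  existsUnique : ∀ x : State n, ∃! γ : ℝ → State n, IsSolution f x γ

/-- The flow `Φ_f(t, x)`: the solution of `ẋ = f x` starting at `x`, evaluated at time `t`. -/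
def flow {n : ℕ} (f : State n → State n) (t : ℝ) (x : State n) : State n :=
  Classical.epsilon (IsSolution f x) t

/-! ### Switching signals

A signal `[0, ∞) → {1, …, M}` is represented by a function `ℝ → Fin M`, of which only the values
at nonnegative times are used. -/

/-- The set of the positive switching instants: the positive times at which `σ` is discontinuous
(`Fin M` carries the discrete topology). -/
def switchSet {M : ℕ} (σ : ℝ → Fin M) : Set ℝ :=
  {t | 0 < t ∧ ¬ ContinuousAt σ t}

/-- `σ` is right continuous and piecewise constant on `[0, ∞)`: it has finitely many
discontinuities in every bounded interval (and, being discrete-valued, is constant between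
consecutive ones). -/
structure IsSignal {M : ℕ} (σ : ℝ → Fin M) : Prop where
  rightContinuous : ∀ t : ℝ, 0 ≤ t → ContinuousWithinAt σ (Ici t) t
  finite_switches : ∀ T : ℝ, (switchSet σ ∩ Iic T).Finite

/-- `t 0 = 0 < t 1 < t 2 < …`, and `t 1, t 2, …` are exactly the positive switching instants
of `σ`; in particular `σ` has infinitely many of them. -/
structure IsSwitchingSeq {M : ℕ} (σ : ℝ → Fin M) (t : ℕ → ℝ) : Prop where
  zero : t 0 = 0
  strictMono : StrictMono t
  image_eq : t '' Ici 1 = switchSet σ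

/-- The class of signals with lower and upper dwell-time bounds `τ₁, τ₂`: every switching
interval, the first one included, has length between `τ₁` and `τ₂`. -/
def Sdw (M : ℕ) (τ₁ τ₂ : ℝ) : Set (ℝ → Fin M) :=
  {σ | IsSignal σ ∧ ∃ t : ℕ → ℝ, IsSwitchingSeq σ t ∧
    ∀ k : ℕ, τ₁ ≤ t (k + 1) - t k ∧ t (k + 1) - t k ≤ τ₂}

/-- The relaxed class: there is no lower bound on the length of the first switching interval. -/
def SdwStar (M : ℕ) (τ₁ τ₂ : ℝ) : Set (ℝ → Fin M) :=
  {σ | IsSignal σ ∧ ∃ t : ℕ → ℝ, IsSwitchingSeq σ t ∧ t 1 ≤ τ₂ ∧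
    ∀ k : ℕ, 1 ≤ k → τ₁ ≤ t (k + 1) - t k ∧ t (k + 1) - t k ≤ τ₂}

/-! ### The switched system -/

/-- `φ` solves `ẋ(t) = f_{σ(t)}(x(t))` on `[0, ∞)` with `x(0) = x`: it is continuous and the
equation holds at every `t ≥ 0` for the right derivative. As signals are right continuous and
piecewise constant, this means that `φ` is differentiable and satisfies the equation away from
the switching instants. -/
structure IsSwitchedSolution {n M : ℕ} (f : Fin M → State n → State n) (σ : ℝ → Fin M)
    (x : State n) (φ : ℝ → State n) : Prop where
  init : φ 0 = x
  continuousOn : ContinuousOn φ (Ici 0)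
  hasDeriv : ∀ t : ℝ, 0 ≤ t → HasDerivWithinAt φ (f (σ t) (φ t)) (Ici t) t

/-- `Φ_σ(t, x)`, for `t ≥ 0`: the solution of the switched system for the signal `σ` starting at
`x`, evaluated at time `t`. -/
def switchedFlow {n M : ℕ} (f : Fin M → State n → State n) (σ : ℝ → Fin M) (t : ℝ)
    (x : State n) : State n :=
  Classical.epsilon (IsSwitchedSolution f σ x) t

/-- Global uniform asymptotic stability on a class `S` of signals. -/
def GUAS {n M : ℕ} (f : Fin M → State n → State n) (S : Set (ℝ → Fin M)) : Prop :=
  ∃ β : ℝ → ℝ → ℝ, ClassKL β ∧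
    ∀ σ ∈ S, ∀ x : State n, ∀ t : ℝ, 0 ≤ t → ‖switchedFlow f σ t x‖ ≤ β ‖x‖ t

/-- The multiple Lyapunov functions: continuous `W i⁻, W i⁺` with common `𝒦_∞` bounds, such that
`W i⁺(Φ_i(τ₁, x)) ≤ e^{-τ₁} W i⁻(x)` and, for `j ≠ i` and `t ∈ [0, τ₂ - τ₁]`,
`W j⁻(Φ_i(t, x)) ≤ e^{-t} W i⁺(x)`. -/
def HasLyapunovFunctions {n M : ℕ} (f : Fin M → State n → State n) (τ₁ τ₂ : ℝ) : Prop :=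
  ∃ (α₁ α₂ : ℝ → ℝ) (Wm Wp : Fin M → State n → ℝ),
    ClassKInf α₁ ∧ ClassKInf α₂ ∧
    (∀ i, Continuous (Wm i)) ∧ (∀ i, Continuous (Wp i)) ∧
    (∀ i x, α₁ ‖x‖ ≤ Wm i x ∧ Wm i x ≤ α₂ ‖x‖) ∧
    (∀ i x, α₁ ‖x‖ ≤ Wp i x ∧ Wp i x ≤ α₂ ‖x‖) ∧
    (∀ i x, Wp i (flow (f i) τ₁ x) ≤ Real.exp (-τ₁) * Wm i x) ∧
    (∀ i j, i ≠ j → ∀ t ∈ Icc 0 (τ₂ - τ₁), ∀ x,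
      Wm j (flow (f i) t x) ≤ Real.exp (-t) * Wp i x)

end

end SwitchedSystem

open Set Filter Topology

namespace SwitchedSystem

/-! ### Flows and trajectories -/

theorem exists_common_lipschitzOnWith {ι E F : Type*} [Fintype ι] [PseudoMetricSpace E]
    [PseudoMetricSpace F] {f : ι → E → F} (hf : ∀ i, LocallyLipschitz (f i)) {B : Set E}
    (hB : IsCompact B) : ∃ L, ∀ i, LipschitzOnWith L (f i) B := by
  have h (i) : ∃ L, LipschitzOnWith L (f i) B :=
    LocallyLipschitzOn.exists_lipschitzOnWith_of_compact hB ((hf i).locallyLipschitzOn (s := B))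
  choose L hL using h
  exact ⟨Finset.univ.sup L, fun i => (hL i).weaken (Finset.le_sup (Finset.mem_univ i))⟩

/-- Two trajectories of a switched family that agree at the left endpoint agree. -/
theorem eqOn_of_trajectories {n M : ℕ} {f : Fin M → State n → State n}
    (hf : ∀ i, LocallyLipschitz (f i)) {σ : ℝ → Fin M} {φ ψ : ℝ → State n} {a b : ℝ}
    (hφ : ContinuousOn φ (Icc a b))
    (hφ' : ∀ t ∈ Ico a b, HasDerivWithinAt φ (f (σ t) (φ t)) (Ici t) t)
    (hψ : ContinuousOn ψ (Icc a b))
    (hψ' : ∀ t ∈ Ico a b, HasDerivWithinAt ψ (f (σ t) (ψ t)) (Ici t) t)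
    (h : φ a = ψ a) : EqOn φ ψ (Icc a b) := by
  have hB : IsCompact (φ '' Icc a b ∪ ψ '' Icc a b) :=
    (isCompact_Icc.image_of_continuousOn hφ).union (isCompact_Icc.image_of_continuousOn hψ)
  obtain ⟨L, hL⟩ := exists_common_lipschitzOnWith hf hB
  intro t ht
  have := dist_le_of_trajectories_ODE_of_mem (v := fun t => f (σ t)) (fun t _ => hL (σ t)) hφ hφ'
    (fun t ht => Or.inl (mem_image_of_mem φ (Ico_subset_Icc_self ht))) hψ hψ'
    (fun t ht => Or.inr (mem_image_of_mem ψ (Ico_subset_Icc_self ht)))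
    (le_of_eq (by rw [h, dist_self])) t ht
  rw [zero_mul] at this
  exact dist_le_zero.mp this

theorem eqOn_of_solutions {n : ℕ} {f : State n → State n} (hf : LocallyLipschitz f)
    {φ ψ : ℝ → State n} {a b : ℝ} (hφ : ContinuousOn φ (Icc a b))
    (hφ' : ∀ t ∈ Ico a b, HasDerivWithinAt φ (f (φ t)) (Ici t) t)
    (hψ : ContinuousOn ψ (Icc a b))
    (hψ' : ∀ t ∈ Ico a b, HasDerivWithinAt ψ (f (ψ t)) (Ici t) t)
    (h : φ a = ψ a) : EqOn φ ψ (Icc a b) :=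
  eqOn_of_trajectories (M := 1) (f := fun _ => f) (fun _ => hf) (σ := fun _ => 0)
    hφ hφ' hψ hψ' h

namespace Regular

variable {n : ℕ} {f : State n → State n}

theorem isSolution_flow (hf : Regular f) (x : State n) :
    IsSolution f x (fun t => flow f t x) :=
  Classical.epsilon_spec (hf.existsUnique x).exists

theorem hasDerivAt_flow (hf : Regular f) (x : State n) (t : ℝ) :
    HasDerivAt (fun t => flow f t x) (f (flow f t x)) t :=
  (hf.isSolution_flow x).2 t

theorem flow_zero (hf : Regular f) (x : State n) : flow f 0 x = x :=
  (hf.isSolution_flow x).1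

theorem eq_flow (hf : Regular f) {x : State n} {γ : ℝ → State n} (h : IsSolution f x γ) (t : ℝ) :
    γ t = flow f t x :=
  congrFun ((hf.existsUnique x).unique h (hf.isSolution_flow x)) t

theorem flow_apply_zero (hf : Regular f) (t : ℝ) : flow f t 0 = 0 :=
  (hf.eq_flow (γ := fun _ => 0) ⟨rfl, fun t => by
    simpa [hf.map_zero] using hasDerivAt_const t (0 : State n)⟩ t).symm

theorem flow_add (hf : Regular f) (s t : ℝ) (x : State n) :
    flow f (s + t) x = flow f s (flow f t x) := by
  refine hf.eq_flow (γ := fun s => flow f (s + t) x) ⟨by simp, fun s => ?_⟩ s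
  exact (hf.hasDerivAt_flow x (s + t)).comp_add_const s t

theorem continuous_flow_time (hf : Regular f) (x : State n) : Continuous (fun t => flow f t x) :=
  continuous_iff_continuousAt.2 fun t => (hf.hasDerivAt_flow x t).continuousAt

/-- Continuous induction on time. With `L` a Lipschitz constant on the unit tube around the
reference orbit, `δ = e^{-LT}` keeps the Grönwall bound strictly below 1, so the perturbed orbit
cannot reach the boundary of the tube and the estimate propagates. -/
theorem dist_flow_le (hf : Regular f) (x : State n) (T : ℝ) :
    ∃ δ > 0, ∃ C ≥ 0, ∀ y, dist y x < δ → ∀ t ∈ Icc 0 T,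
      dist (flow f t y) (flow f t x) ≤ C * dist y x := by
  set K : Set (State n) := (fun t => flow f t x) '' Icc 0 T with hK
  have hKc : IsCompact K := isCompact_Icc.image (hf.continuous_flow_time x)
  have hB : IsCompact (Metric.cthickening 1 K) := hKc.cthickening
  obtain ⟨L, hL⟩ := LocallyLipschitzOn.exists_lipschitzOnWith_of_compact hB
    (hf.locallyLipschitz.locallyLipschitzOn (s := Metric.cthickening 1 K))
  have hxK : ∀ t ∈ Icc 0 T, flow f t x ∈ K := fun t ht => mem_image_of_mem _ ht
  refine ⟨(Real.exp (L * T))⁻¹, by positivity, Real.exp (L * T), by positivity, fun y hy => ?_⟩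
  have hlt : Real.exp (L * T) * dist y x < 1 := by
    have := mul_lt_mul_of_pos_left hy (Real.exp_pos (L * T))
    rwa [mul_inv_cancel₀ (Real.exp_ne_zero _)] at this
  have hcont : Continuous fun t => dist (flow f t y) (flow f t x) :=
    (hf.continuous_flow_time y).dist (hf.continuous_flow_time x)
  rcases lt_or_ge T 0 with hT | hT
  · intro t ht
    exact absurd (ht.1.trans ht.2) (not_le.2 hT)
  refine IsClosed.Icc_subset_of_forall_mem_nhdsGT_of_Icc_subset
    (s := {t | dist (flow f t y) (flow f t x) ≤ Real.exp (L * T) * dist y x}) ?_ ?_ ?_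
  · exact (isClosed_le hcont continuous_const).inter isClosed_Icc
  · simp only [mem_ofPred_eq, hf.flow_zero]
    exact le_mul_of_one_le_left dist_nonneg (Real.one_le_exp (by positivity))
  · intro t ht hsub
    have h1 : dist (flow f t y) (flow f t x) < 1 := lt_of_le_of_lt (hsub ⟨ht.1, le_rfl⟩) hlt
    have h2 : ∀ᶠ u in 𝓝 t, dist (flow f u y) (flow f u x) < 1 := hcont.continuousAt.eventually_lt
      continuousAt_const h1
    obtain ⟨ε, hε, hε'⟩ := Metric.eventually_nhds_iff.1 h2
    have h3 : ∀ᶠ u in 𝓝[>] t, u ∈ Ioo t (min (t + ε) T) :=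
      Ioo_mem_nhdsGT (lt_min (by linarith) ht.2)
    filter_upwards [h3] with u hu
    have hu1 : u < t + ε := hu.2.trans_le (min_le_left _ _)
    have hu2 : u < T := hu.2.trans_le (min_le_right _ _)
    have hu0 : 0 ≤ u := ht.1.trans hu.1.le
    have hmem : ∀ w ∈ Ico 0 u, dist (flow f w y) (flow f w x) ≤ 1 := by
      intro w hw
      rcases le_or_gt w t with hwt | hwt
      · exact (hsub ⟨hw.1, hwt⟩).trans hlt.le
      · refine (hε' ?_).le
        rw [Real.dist_eq, abs_of_pos (by linarith)]
        linarith [hw.2]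
    have hmK : ∀ w ∈ Ico 0 u, flow f w x ∈ K := fun w hw => hxK w ⟨hw.1, by linarith [hw.2]⟩
    have := dist_le_of_trajectories_ODE_of_mem (v := fun _ => f)
      (s := fun _ => Metric.cthickening 1 K) (fun _ _ => hL)
      (hf.continuous_flow_time y).continuousOn
      (fun w _ => (hf.hasDerivAt_flow y w).hasDerivWithinAt)
      (fun w hw => Metric.mem_cthickening_of_dist_le _ _ _ _ (hmK w hw) (hmem w hw))
      (hf.continuous_flow_time x).continuousOn
      (fun w _ => (hf.hasDerivAt_flow x w).hasDerivWithinAt)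
      (fun w hw => Metric.self_subset_cthickening _ (hmK w hw))
      (δ := dist y x) (by simp [hf.flow_zero]) u ⟨hu0, le_rfl⟩
    refine this.trans ?_
    rw [mul_comm]
    gcongr
    linarith

/-- `dist_flow_le` only looks forward in time; the absolute value turns this into a globally
continuous function, the form in which suprema over compact time intervals are later shown to be
continuous. -/
theorem continuous_flow_abs (hf : Regular f) :
    Continuous (fun p : ℝ × State n => flow f |p.1| p.2) := by
  rw [continuous_iff_continuousAt]
  rintro ⟨t, x⟩
  obtain ⟨δ, hδ, C, -, h⟩ := hf.dist_flow_le x (|t| + 1)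
  rw [ContinuousAt, tendsto_iff_dist_tendsto_zero]
  have hlim : Tendsto (fun p : ℝ × State n =>
      C * dist p.2 x + dist (flow f |p.1| x) (flow f |t| x)) (𝓝 (t, x)) (𝓝 0) := by
    have hc : Continuous (fun p : ℝ × State n =>
        C * dist p.2 x + dist (flow f |p.1| x) (flow f |t| x)) := by
      have := (hf.continuous_flow_time x).comp
        (continuous_abs.comp (continuous_fst (X := ℝ) (Y := State n)))
      exact (continuous_const.mul (continuous_snd.dist continuous_const)).add
        (this.dist continuous_const)
    simpa using hc.tendsto (t, x)
  refine squeeze_zero' (Eventually.of_forall fun _ => dist_nonneg) ?_ hlim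
  have e1 : ∀ᶠ p : ℝ × State n in 𝓝 (t, x), dist p.2 x < δ :=
    (continuous_snd.dist continuous_const).continuousAt.eventually_lt continuousAt_const (by simpa)
  have e2 : ∀ᶠ p : ℝ × State n in 𝓝 (t, x), |p.1| < |t| + 1 :=
    (continuous_abs.comp continuous_fst).continuousAt.eventually_lt continuousAt_const (by simp)
  filter_upwards [e1, e2] with p h1 h2
  exact (dist_triangle _ (flow f |p.1| x) _).trans
    (add_le_add_left (h p.2 h1 _ ⟨abs_nonneg _, h2.le⟩) _)

theorem continuous_flow_space (hf : Regular f) {t : ℝ} (ht : 0 ≤ t) :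
    Continuous (fun x => flow f t x) := by
  have := hf.continuous_flow_abs.comp (Continuous.prodMk_right (X := ℝ) (Y := State n) t)
  simpa [Function.comp_def, abs_of_nonneg ht] using this

end Regular

/-! ### Solutions of the switched system -/

namespace IsSwitchedSolution

variable {n M : ℕ} {f : Fin M → State n → State n} {σ : ℝ → Fin M} {x y : State n}
  {φ ψ : ℝ → State n}

theorem eqOn (hf : ∀ i, Regular (f i)) (hφ : IsSwitchedSolution f σ x φ)
    (hψ : IsSwitchedSolution f σ x ψ) : EqOn φ ψ (Ici 0) := fun _ ht =>
  eqOn_of_trajectories (fun i => (hf i).locallyLipschitz) (hφ.continuousOn.mono Icc_subset_Ici_self)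
    (fun t ht => hφ.hasDeriv t ht.1) (hψ.continuousOn.mono Icc_subset_Ici_self)
    (fun t ht => hψ.hasDeriv t ht.1) (hφ.init.trans hψ.init.symm) ⟨ht, le_rfl⟩

theorem isSwitchedSolution_switchedFlow (h : IsSwitchedSolution f σ x φ) :
    IsSwitchedSolution f σ x (fun t => switchedFlow f σ t x) :=
  Classical.epsilon_spec (p := IsSwitchedSolution f σ x) ⟨φ, h⟩

theorem switchedFlow_eq (hf : ∀ i, Regular (f i)) (h : IsSwitchedSolution f σ x φ) {t : ℝ}
    (ht : 0 ≤ t) : switchedFlow f σ t x = φ t :=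
  (h.isSwitchedSolution_switchedFlow.eqOn hf h) ht

/-- While the signal is constant, the trajectory follows the flow of the active mode. -/
theorem eq_flow (hf : ∀ i, Regular (f i)) (hφ : IsSwitchedSolution f σ x φ) {a b : ℝ} {i : Fin M}
    (ha : 0 ≤ a) (hσ : ∀ t ∈ Ico a b, σ t = i) {t : ℝ} (ht : t ∈ Icc a b) :
    φ t = flow (f i) (t - a) (φ a) := by
  refine eqOn_of_solutions (hf i).locallyLipschitz (φ := φ)
    (ψ := fun t => flow (f i) (t - a) (φ a)) (a := a) (b := b)
    (hφ.continuousOn.mono fun u hu => ha.trans hu.1) ?_ ?_ ?_ ?_ ht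
  · intro u hu
    simpa [hσ u hu] using hφ.hasDeriv u (ha.trans hu.1)
  · exact (((hf i).continuous_flow_time _).comp (continuous_id.sub continuous_const)).continuousOn
  · intro u _
    exact (((hf i).hasDerivAt_flow (φ a) (u - a)).comp_sub_const u a).hasDerivWithinAt
  · simp [(hf i).flow_zero]

/-- The time shift of a trajectory is a trajectory for the shifted signal. -/
theorem shift (hφ : IsSwitchedSolution f σ x φ) {a : ℝ} (ha : 0 ≤ a) {σ' : ℝ → Fin M}
    (hσ : ∀ t, 0 ≤ t → σ' t = σ (t + a)) :
    IsSwitchedSolution f σ' (φ a) (fun t => φ (t + a)) where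
  init := by simp
  continuousOn := hφ.continuousOn.comp (by fun_prop) fun t (ht : 0 ≤ t) => add_nonneg ht ha
  hasDeriv t ht := by
    have h1 := hφ.hasDeriv (t + a) (add_nonneg ht ha)
    have h2 : HasDerivWithinAt (fun t : ℝ => t + a) 1 (Ici t) t :=
      ((hasDerivAt_id t).add_const a).hasDerivWithinAt
    have := h1.scomp t h2 (fun u hu => by simpa using hu)
    rw [hσ t ht]
    simpa [Function.comp_def] using this

/-- Trajectories of the same signal that stay in a set where all the modes are Lipschitz. -/
theorem dist_le (hφ : IsSwitchedSolution f σ x φ) (hψ : IsSwitchedSolution f σ y ψ)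
    {B : Set (State n)} {L : NNReal} (hL : ∀ i, LipschitzOnWith L (f i) B)
    (hφB : ∀ t, 0 ≤ t → φ t ∈ B) (hψB : ∀ t, 0 ≤ t → ψ t ∈ B) {t : ℝ} (ht : 0 ≤ t) :
    dist (φ t) (ψ t) ≤ dist x y * Real.exp (L * t) := by
  have := dist_le_of_trajectories_ODE_of_mem (v := fun t => f (σ t)) (s := fun _ => B)
    (a := 0) (b := t) (fun t _ => hL (σ t))
    (hφ.continuousOn.mono Icc_subset_Ici_self) (fun t ht => hφ.hasDeriv t ht.1)
    (fun t ht => hφB t ht.1) (hψ.continuousOn.mono Icc_subset_Ici_self)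
    (fun t ht => hψ.hasDeriv t ht.1) (fun t ht => hψB t ht.1)
    (le_of_eq (by rw [hφ.init, hψ.init])) t ⟨ht, le_rfl⟩
  simpa using this

end IsSwitchedSolution

end SwitchedSystem

namespace SwitchedSystem

/-! ### Switching signals -/

variable {n M : ℕ} {σ : ℝ → Fin M} {t : ℕ → ℝ}

namespace IsSwitchingSeq

theorem nonneg (ht : IsSwitchingSeq σ t) (k : ℕ) : 0 ≤ t k :=
  ht.zero ▸ ht.strictMono.monotone (Nat.zero_le k)

theorem tendsto_atTop (ht : IsSwitchingSeq σ t) (hσ : IsSignal σ) : Tendsto t atTop atTop := by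
  refine tendsto_atTop_atTop_of_monotone ht.strictMono.monotone fun T => ?_
  by_contra! h
  refine ((Ici_infinite 1).image (ht.strictMono.injective.injOn (s := Ici 1))) ?_
  refine (hσ.finite_switches T).subset ?_
  rw [ht.image_eq]
  refine fun s hs => ⟨hs, ?_⟩
  rw [← ht.image_eq] at hs
  obtain ⟨k, -, rfl⟩ := hs
  exact (h k).le

theorem exists_mem_Ico (ht : IsSwitchingSeq σ t) (hσ : IsSignal σ) {s : ℝ} (hs : 0 ≤ s) :
    ∃ k, s ∈ Ico (t k) (t (k + 1)) := by
  have hex : ∃ k, s < t (k + 1) :=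
    (((tendsto_add_atTop_iff_nat 1).2 (ht.tendsto_atTop hσ)).eventually_gt_atTop s).exists
  classical
  refine ⟨Nat.find hex, ?_, Nat.find_spec hex⟩
  rcases hk : Nat.find hex with _ | m
  · rwa [ht.zero]
  · exact not_lt.1 (Nat.find_min hex (m := m) (by omega))

theorem continuousOn_Ico (ht : IsSwitchingSeq σ t) (hσ : IsSignal σ) (k : ℕ) :
    ContinuousOn σ (Ico (t k) (t (k + 1))) := by
  intro s hs
  rcases hs.1.eq_or_lt with h | h
  · subst h
    exact (hσ.rightContinuous _ (ht.nonneg k)).mono Ico_subset_Ici_self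
  · have hs' : s ∉ switchSet σ := by
      rw [← ht.image_eq]
      rintro ⟨m, -, rfl⟩
      have h1 := ht.strictMono.lt_iff_lt.1 h
      have h2 := ht.strictMono.lt_iff_lt.1 hs.2
      omega
    have : ContinuousAt σ s := by
      by_contra hc
      exact hs' ⟨(ht.nonneg k).trans_lt h, hc⟩
    exact this.continuousWithinAt

theorem eq_of_mem_Ico (ht : IsSwitchingSeq σ t) (hσ : IsSignal σ) {k : ℕ} {s : ℝ}
    (hs : s ∈ Ico (t k) (t (k + 1))) : σ s = σ (t k) :=
  isPreconnected_Ico.constant (ht.continuousOn_Ico hσ k) hs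
    ⟨le_rfl, ht.strictMono (Nat.lt_succ_self k)⟩

/-- Equal values on consecutive intervals would make `σ` left continuous at the instant between
them, hence continuous there. This supplies the condition `i ≠ j` of the switching inequality. -/
theorem ne_succ (ht : IsSwitchingSeq σ t) (hσ : IsSignal σ) (k : ℕ) :
    σ (t k) ≠ σ (t (k + 1)) := by
  intro h
  have hmem : t (k + 1) ∈ switchSet σ := by
    rw [← ht.image_eq]
    exact ⟨k + 1, by simp, rfl⟩
  refine hmem.2 (continuousAt_iff_continuous_left_right.2
    ⟨continuousWithinAt_Iio_iff_Iic.1 ?_, hσ.rightContinuous _ (ht.nonneg _)⟩)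
  have hev : ∀ᶠ s in 𝓝[<] t (k + 1), σ s = σ (t (k + 1)) := by
    filter_upwards [Ico_mem_nhdsLT (ht.strictMono (Nat.lt_succ_self k))] with s hs
    rw [ht.eq_of_mem_Ico hσ hs, h]
  exact tendsto_const_nhds.congr' (hev.mono fun _ h => h.symm)

end IsSwitchingSeq

/-- The states of the switched system at the successive switching instants. -/
noncomputable def switchState (f : Fin M → State n → State n) (σ : ℝ → Fin M) (t : ℕ → ℝ)
    (x : State n) : ℕ → State n
  | 0 => x
  | k + 1 => flow (f (σ (t k))) (t (k + 1) - t k) (switchState f σ t x k)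

/-- The flow pieces on successive intervals are glued; they match at the switching instants by the
recursion of `switchState`. Without existence, the `epsilon` in `switchedFlow` carries no
information. -/
theorem exists_isSwitchedSolution {f : Fin M → State n → State n} (hf : ∀ i, Regular (f i))
    (hσ : IsSignal σ) (ht : IsSwitchingSeq σ t) (x : State n) :
    ∃ φ, IsSwitchedSolution f σ x φ := by
  have hidx (s : ℝ) : ∃ k, 0 ≤ s → s ∈ Ico (t k) (t (k + 1)) := by
    by_cases hs : 0 ≤ s
    · obtain ⟨k, hk⟩ := ht.exists_mem_Ico hσ hs
      exact ⟨k, fun _ => hk⟩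
    · exact ⟨0, fun h => absurd h hs⟩
  choose idx hidx using hidx
  have hidx_eq {k : ℕ} {s : ℝ} (hs : s ∈ Ico (t k) (t (k + 1))) : idx s = k := by
    have h := hidx s ((ht.nonneg k).trans hs.1)
    have h1 := ht.strictMono.lt_iff_lt.1 (h.1.trans_lt hs.2)
    have h2 := ht.strictMono.lt_iff_lt.1 (hs.1.trans_lt h.2)
    omega
  let y := switchState f σ t x
  let ψ (k : ℕ) (s : ℝ) : State n := flow (f (σ (t k))) (s - t k) (y k)
  have hψ (k : ℕ) (s : ℝ) : HasDerivAt (ψ k) (f (σ (t k)) (ψ k s)) s :=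
    ((hf (σ (t k))).hasDerivAt_flow (y k) (s - t k)).comp_sub_const s (t k)
  have hψ0 (k : ℕ) : ψ k (t k) = y k := by simp [ψ, (hf _).flow_zero]
  let φ (s : ℝ) : State n := ψ (idx s) s
  have hIco (k : ℕ) {s : ℝ} (hs : s ∈ Ico (t k) (t (k + 1))) : φ s = ψ k s := by
    simp only [φ, hidx_eq hs]
  have hIcc (k : ℕ) {s : ℝ} (hs : s ∈ Icc (t k) (t (k + 1))) : φ s = ψ k s := by
    rcases hs.2.eq_or_lt with rfl | h
    · rw [hIco (k + 1) ⟨le_rfl, ht.strictMono (Nat.lt_succ_self _)⟩, hψ0]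
      rfl
    · exact hIco k ⟨hs.1, h⟩
  have hderiv (s : ℝ) (hs : 0 ≤ s) : HasDerivWithinAt φ (f (σ s) (φ s)) (Ici s) s := by
    obtain ⟨k, hk⟩ := ht.exists_mem_Ico hσ hs
    have h := (hψ k s).hasDerivWithinAt (s := Ici s)
    rw [ht.eq_of_mem_Ico hσ hk, hIco k hk]
    refine h.congr_of_eventuallyEq ?_ (hIco k hk)
    filter_upwards [Ico_mem_nhdsGE hk.2] with u hu
    exact hIco k ⟨hk.1.trans hu.1, hu.2⟩
  refine ⟨φ, ?_, ?_, hderiv⟩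
  · have : (0 : ℝ) ∈ Ico (t 0) (t 1) := ⟨ht.zero.le, ht.zero ▸ ht.strictMono Nat.zero_lt_one⟩
    have h := hψ0 0
    rw [ht.zero] at h
    rw [hIco 0 this, h]
    rfl
  · intro s (hs : 0 ≤ s)
    have hr : ContinuousWithinAt φ (Ici s) s := (hderiv s hs).continuousWithinAt
    rcases hs.eq_or_lt with rfl | hpos
    · exact hr
    · refine (continuousAt_iff_continuous_left_right.2
        ⟨continuousWithinAt_Iio_iff_Iic.1 ?_, hr⟩).continuousWithinAt
      have hk : ∃ k, s ∈ Ioc (t k) (t (k + 1)) := by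
        obtain ⟨k, hk⟩ := ht.exists_mem_Ico hσ hs
        rcases hk.1.eq_or_lt with h | h
        · rcases k with _ | k
          · exact absurd (ht.zero.symm.trans h) hpos.ne
          · exact ⟨k, h ▸ ht.strictMono (Nat.lt_succ_self k), h.ge⟩
        · exact ⟨k, h, hk.2.le⟩
      obtain ⟨k, hk⟩ := hk
      have h := (hψ k s).continuousAt.continuousWithinAt (s := Iio s)
      refine h.congr_of_eventuallyEq ?_ (hIcc k ⟨hk.1.le, hk.2⟩)
      filter_upwards [Ico_mem_nhdsLT hk.1] with u hu
      exact hIcc k ⟨hu.1, hu.2.le.trans hk.2⟩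

theorem Sdw_subset_SdwStar (M : ℕ) (τ₁ τ₂ : ℝ) : Sdw M τ₁ τ₂ ⊆ SdwStar M τ₁ τ₂ := by
  rintro σ ⟨hσ, t, ht, h⟩
  refine ⟨hσ, t, ht, ?_, fun k _ => h k⟩
  simpa [ht.zero] using (h 0).2

theorem isSwitchedSolution_switchedFlow_of_mem_SdwStar {f : Fin M → State n → State n}
    (hf : ∀ i, Regular (f i)) {τ₁ τ₂ : ℝ} (hσ : σ ∈ SdwStar M τ₁ τ₂) (x : State n) :
    IsSwitchedSolution f σ x (fun s => switchedFlow f σ s x) := by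
  obtain ⟨hsig, t, ht, -⟩ := hσ
  obtain ⟨φ, hφ⟩ := exists_isSwitchedSolution hf hsig ht x
  exact hφ.isSwitchedSolution_switchedFlow

/-! ### Prepending a constant mode -/

open Classical in
/-- The signal that equals `i` before time `a` and then follows `σ`. -/
noncomputable def prepend (i : Fin M) (a : ℝ) (σ : ℝ → Fin M) (s : ℝ) : Fin M :=
  if s < a then i else σ (s - a)

theorem prepend_of_lt {i : Fin M} {a s : ℝ} (h : s < a) : prepend i a σ s = i := if_pos h

theorem prepend_of_ge {i : Fin M} {a s : ℝ} (h : a ≤ s) : prepend i a σ s = σ (s - a) :=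
  if_neg h.not_gt

theorem prepend_eventuallyEq_of_lt {i : Fin M} {a s : ℝ} (h : s < a) :
    prepend i a σ =ᶠ[𝓝 s] fun _ => i := by
  filter_upwards [Iio_mem_nhds h] with u hu using prepend_of_lt hu

theorem continuousAt_prepend_of_gt {i : Fin M} {a s : ℝ} (h : a < s) :
    ContinuousAt (prepend i a σ) s ↔ ContinuousAt σ (s - a) := by
  have h1 : prepend i a σ =ᶠ[𝓝 s] σ ∘ (Homeomorph.subRight a) := by
    filter_upwards [Ioi_mem_nhds h] with u hu using prepend_of_ge (le_of_lt hu)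
  rw [continuousAt_congr h1]
  exact (Homeomorph.subRight a).comp_continuousAt_iff' σ s

theorem not_continuousAt_prepend {i : Fin M} {a : ℝ} (hi : σ 0 ≠ i) :
    ¬ ContinuousAt (prepend i a σ) a := by
  intro h
  have h1 : ∀ᶠ s in 𝓝 a, prepend i a σ s = prepend i a σ a :=
    h.eventually_mem (s := {prepend i a σ a}) (by simp)
  have h2 : ∀ᶠ s in 𝓝[<] a, prepend i a σ s = i := by
    filter_upwards [self_mem_nhdsWithin] with s hs using prepend_of_lt hs
  obtain ⟨s, hs1, hs2⟩ := ((h1.filter_mono nhdsWithin_le_nhds).and h2).exists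
  rw [hs2, prepend_of_ge le_rfl, sub_self] at hs1
  exact hi hs1.symm

theorem switchSet_prepend {i : Fin M} {a : ℝ} (ha : 0 < a) (hi : σ 0 ≠ i) :
    switchSet (prepend i a σ) = insert a ((fun s => s + a) '' switchSet σ) := by
  ext s
  simp only [switchSet, mem_ofPred_eq, mem_insert_iff, mem_image]
  rcases lt_trichotomy s a with h | rfl | h
  · have hc : ContinuousAt (prepend i a σ) s :=
      (continuousAt_congr (prepend_eventuallyEq_of_lt h)).2 continuousAt_const
    simp only [hc, not_true, and_false, false_iff, not_or, not_exists, not_and]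
    exact ⟨h.ne, fun u hu _ => by linarith [hu.1]⟩
  · simp [ha, not_continuousAt_prepend hi]
  · rw [continuousAt_prepend_of_gt h]
    constructor
    · exact fun hs => Or.inr ⟨s - a, ⟨by linarith, hs.2⟩, by ring⟩
    · rintro (rfl | ⟨u, hu, rfl⟩)
      · exact absurd h (lt_irrefl _)
      · exact ⟨by linarith, by simpa using hu.2⟩

theorem prepend_mem_Sdw {i : Fin M} {a τ₁ τ₂ : ℝ} (hσ : σ ∈ Sdw M τ₁ τ₂) (ha : 0 < a)
    (h₁ : τ₁ ≤ a) (h₂ : a ≤ τ₂) (hi : σ 0 ≠ i) : prepend i a σ ∈ Sdw M τ₁ τ₂ := by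
  obtain ⟨hsig, t, ht, hdw⟩ := hσ
  -- The old initial time `t 0 = 0` becomes the first switching instant `a`, a genuine discontinuity
  -- because `σ 0 ≠ i`.
  refine ⟨⟨fun s hs => ?_, fun T => ?_⟩, fun k => k.casesOn 0 fun k => t k + a, ⟨rfl, ?_, ?_⟩, ?_⟩
  · rcases lt_or_ge s a with h | h
    · exact ((continuousAt_congr (prepend_eventuallyEq_of_lt h)).2
        continuousAt_const).continuousWithinAt
    · have h1 : ContinuousWithinAt (fun u => σ (u - a)) (Ici s) s :=
        ContinuousWithinAt.comp (f := fun u : ℝ => u - a) (g := σ) (t := Ici (s - a))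
          (hsig.rightContinuous (s - a) (by linarith))
          (by fun_prop : Continuous fun u : ℝ => u - a).continuousWithinAt
          (fun u (hu : s ≤ u) => sub_le_sub_right hu a)
      exact h1.congr (fun u hu => prepend_of_ge (h.trans hu)) (prepend_of_ge h)
  · rw [switchSet_prepend ha hi]
    refine (((hsig.finite_switches (T - a)).image (fun s => s + a)).insert a).subset ?_
    rintro s ⟨rfl | ⟨u, hu, rfl⟩, hs⟩
    · exact mem_insert _ _
    · exact mem_insert_of_mem _ ⟨u, ⟨hu, by simpa using le_sub_iff_add_le.2 hs⟩, rfl⟩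
  · refine strictMono_nat_of_lt_succ fun k => ?_
    rcases k with _ | k
    · simpa [ht.zero] using ha
    · simpa using ht.strictMono (Nat.lt_succ_self k)
  · rw [switchSet_prepend ha hi, ← ht.image_eq]
    ext s
    simp only [mem_image, mem_Ici, mem_insert_iff]
    constructor
    · rintro ⟨k, hk, rfl⟩
      rcases k with _ | _ | k
      · omega
      · exact Or.inl (by simp [ht.zero])
      · exact Or.inr ⟨t (k + 1), ⟨k + 1, by omega, rfl⟩, rfl⟩
    · rintro (rfl | ⟨_, ⟨k, hk, rfl⟩, rfl⟩)
      · exact ⟨1, le_rfl, by simp [ht.zero]⟩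
      · exact ⟨k + 1, by omega, rfl⟩
  · intro k
    rcases k with _ | k
    · simpa [ht.zero] using ⟨h₁, h₂⟩
    · simpa using hdw k

theorem switchedFlow_prepend {f : Fin M → State n → State n} (hf : ∀ i, Regular (f i))
    {i : Fin M} {a τ₁ τ₂ : ℝ} (hσ : σ ∈ Sdw M τ₁ τ₂) (ha : 0 < a)
    (h₁ : τ₁ ≤ a) (h₂ : a ≤ τ₂) (hi : σ 0 ≠ i) (x : State n) {s : ℝ} (hs : 0 ≤ s) :
    switchedFlow f (prepend i a σ) (s + a) x = switchedFlow f σ s (flow (f i) a x) := by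
  have hφ := isSwitchedSolution_switchedFlow_of_mem_SdwStar hf
    (Sdw_subset_SdwStar _ _ _ (prepend_mem_Sdw hσ ha h₁ h₂ hi)) x
  have h := hφ.shift ha.le (σ' := σ) fun u hu => by
    rw [prepend_of_ge (by linarith), add_sub_cancel_right]
  have hx := hφ.eq_flow hf (a := 0) (b := a) le_rfl (fun u hu => prepend_of_lt hu.2)
    (t := a) ⟨ha.le, le_rfl⟩
  simp only [sub_zero, hφ.init] at hx
  simp only [hx] at h
  exact (h.switchedFlow_eq hf hs).symm

/-! ### Alternating signals -/

open Classical in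
/-- The signal that alternates between the modes `i` and `j`, starting with `i`, with period
`τ`. -/
noncomputable def alternating (i j : Fin M) (τ : ℝ) (s : ℝ) : Fin M :=
  if Even ⌊s / τ⌋ then i else j

theorem alternating_zero (i j : Fin M) (τ : ℝ) : alternating i j τ 0 = i := by
  simp [alternating]

theorem alternating_eventuallyEq {i j : Fin M} {τ : ℝ} (hτ : 0 < τ) {m : ℤ} {s : ℝ}
    (hs : s ∈ Ioo (m * τ) ((m + 1) * τ)) :
    alternating i j τ =ᶠ[𝓝 s] fun _ => alternating i j τ s := by
  have h (u : ℝ) (hu : u ∈ Ioo (m * τ) ((m + 1) * τ)) : ⌊u / τ⌋ = m := by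
    rw [Int.floor_eq_iff, le_div_iff₀ hτ, div_lt_iff₀ hτ]
    exact ⟨hu.1.le, hu.2⟩
  filter_upwards [Ioo_mem_nhds hs.1 hs.2] with u hu
  simp [alternating, h u hu, h s hs]

/-- Provides a signal with any prescribed first mode, so that the suprema defining the value
functions run over nonempty sets. -/
theorem alternating_mem_Sdw {i j : Fin M} (hij : i ≠ j) {τ₁ τ₂ : ℝ} (h : τ₁ ≤ τ₂) (hτ : 0 < τ₂) :
    alternating i j τ₂ ∈ Sdw M τ₁ τ₂ := by
  have hval (m : ℤ) (u : ℝ) (hu : u ∈ Ico (m * τ₂) ((m + 1) * τ₂)) :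
      alternating i j τ₂ u = if Even m then i else j := by
    have : ⌊u / τ₂⌋ = m := by
      rw [Int.floor_eq_iff, le_div_iff₀ hτ, div_lt_iff₀ hτ]
      exact hu
    simp [alternating, this]
  have hfl (s : ℝ) : s ∈ Ico (⌊s / τ₂⌋ * τ₂) ((⌊s / τ₂⌋ + 1) * τ₂) := by
    rw [mem_Ico, ← le_div_iff₀ hτ, ← div_lt_iff₀ hτ]
    exact ⟨Int.floor_le _, Int.lt_floor_add_one _⟩
  have hmul : StrictMono fun k : ℕ => (k : ℝ) * τ₂ :=
    fun a b hab => mul_lt_mul_of_pos_right (Nat.cast_lt.2 hab) hτ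
  have hset : (fun k : ℕ => (k : ℝ) * τ₂) '' Ici 1 = switchSet (alternating i j τ₂) := by
    ext s
    constructor
    · rintro ⟨k, hk, rfl⟩
      have hk1 : (1 : ℝ) ≤ k := Nat.one_le_cast.2 hk
      refine ⟨by positivity, fun hc => ?_⟩
      have h1 : ∀ᶠ u in 𝓝 ((k : ℝ) * τ₂), alternating i j τ₂ u = alternating i j τ₂ (k * τ₂) :=
        hc.eventually_mem (s := {alternating i j τ₂ (k * τ₂)}) (by simp)
      have h2 : ∀ᶠ u in 𝓝[<] ((k : ℝ) * τ₂), u ∈ Ico (((k - 1 : ℤ) : ℝ) * τ₂) (k * τ₂) :=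
        Ico_mem_nhdsLT (by push_cast; nlinarith)
      obtain ⟨u, hu1, hu2⟩ := ((h1.filter_mono nhdsWithin_le_nhds).and h2).exists
      rw [hval (k - 1) u ⟨hu2.1, by push_cast; simpa using hu2.2⟩,
        hval k (k * τ₂) ⟨by simp, by push_cast; nlinarith⟩] at hu1
      by_cases hp : Even (k : ℤ)
      · rw [if_neg (by rwa [Int.even_sub_one, not_not]), if_pos hp] at hu1
        exact hij hu1.symm
      · rw [if_pos (by rwa [Int.even_sub_one]), if_neg hp] at hu1
        exact hij hu1
    · rintro ⟨hs0, hs⟩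
      have hm := hfl s
      rcases hm.1.eq_or_lt with heq | hlt
      · have hpos : 0 < ⌊s / τ₂⌋ := by
          have : (0 : ℝ) < ⌊s / τ₂⌋ := by
            by_contra! hle
            nlinarith
          exact_mod_cast this
        refine ⟨⌊s / τ₂⌋.toNat, by simp; omega, ?_⟩
        have : ((⌊s / τ₂⌋.toNat : ℕ) : ℝ) = ⌊s / τ₂⌋ := by
          exact_mod_cast Int.toNat_of_nonneg hpos.le
        simp only [this, heq]
      · exact absurd ((continuousAt_congr (alternating_eventuallyEq hτ ⟨hlt, hm.2⟩)).2
          continuousAt_const) hs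
  refine ⟨⟨fun s _ => ?_, fun T => ?_⟩, fun k => k * τ₂, ⟨by simp, hmul, hset⟩, fun k => ?_⟩
  · have hev : alternating i j τ₂ =ᶠ[𝓝[≥] s] fun _ => alternating i j τ₂ s := by
      filter_upwards [Ico_mem_nhdsGE (hfl s).2] with u hu
      rw [hval _ u ⟨(hfl s).1.trans hu.1, hu.2⟩, hval _ s (hfl s)]
    exact continuousWithinAt_const.congr_of_eventuallyEq hev rfl
  · rw [← hset]
    refine ((finite_Iic ⌊T / τ₂⌋₊).image fun k : ℕ => (k : ℝ) * τ₂).subset ?_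
    rintro _ ⟨⟨k, -, rfl⟩, hk⟩
    exact ⟨k, Nat.le_floor ((le_div_iff₀ hτ).2 hk), rfl⟩
  · push_cast
    constructor <;> linarith

end SwitchedSystem

namespace SwitchedSystem

/-! ### Comparison functions -/

theorem ClassK.nonneg {α : ℝ → ℝ} (h : ClassK α) {s : ℝ} (hs : 0 ≤ s) : 0 ≤ α s := by
  rw [← h.map_zero]
  exact h.strictMonoOn.monotoneOn (mem_Ici.2 le_rfl) hs hs

theorem ClassK.mono {α : ℝ → ℝ} (h : ClassK α) {s t : ℝ} (hs : 0 ≤ s) (hst : s ≤ t) :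
    α s ≤ α t :=
  h.strictMonoOn.monotoneOn hs (hs.trans hst) hst

theorem ClassKInf.id : ClassKInf fun s => s where
  continuousOn := continuousOn_id
  map_zero := rfl
  strictMonoOn := strictMonoOn_id
  unbounded C := ⟨|C| + 1, by positivity, by linarith [le_abs_self C]⟩

/-- A continuous function that vanishes at the origin is bounded by a `𝒦_∞` function of the
norm. -/
theorem exists_classKInf_majorant {E : Type*} [NormedAddCommGroup E] [NormedSpace ℝ E]
    [ProperSpace E] {g : E → ℝ} (hg : Continuous g) (h0 : g 0 = 0) :
    ∃ α : ℝ → ℝ, ClassKInf α ∧ Continuous α ∧ (∀ r, 0 ≤ r → r ≤ α r) ∧ ∀ x, g x ≤ α ‖x‖ := by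
  let B : Set E := Metric.closedBall 0 1
  have hB : IsCompact B := isCompact_closedBall 0 1
  have h0B : (0 : E) ∈ B := by simp [B]
  let F (r : ℝ) (u : E) : ℝ := |g (r • u)|
  -- The maximum of `|g|` on the ball of radius `r`, parametrized by the fixed unit ball so that it
  -- is continuous in `r`. Adding `r` below makes it strictly increasing and unbounded.
  let m (r : ℝ) : ℝ := sSup (F r '' B)
  have hF : Continuous (Function.uncurry F) := by
    simp only [F, Function.uncurry_def]
    fun_prop
  have hm : Continuous m := hB.continuous_sSup hF
  have hbdd (r : ℝ) : BddAbove (F r '' B) :=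
    (hB.image (hF.comp (Continuous.prodMk_right r))).bddAbove
  have hle (r : ℝ) {u : E} (hu : u ∈ B) : F r u ≤ m r := le_csSup (hbdd r) (mem_image_of_mem _ hu)
  have hm0 : m 0 = 0 := by
    have : F 0 '' B = {0} := by
      ext v
      simp only [F, zero_smul, h0, abs_zero, mem_image, mem_singleton_iff]
      exact ⟨fun ⟨_, _, h⟩ => h.symm, fun h => ⟨0, h0B, h.symm⟩⟩
    simp [m, this]
  have hmono {r r' : ℝ} (hr : 0 ≤ r) (hrr : r ≤ r') : m r ≤ m r' := by
    refine csSup_le ((nonempty_of_mem h0B).image _) ?_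
    rintro _ ⟨u, hu, rfl⟩
    rcases hr.eq_or_lt with rfl | hpos
    · simpa [F, h0] using hle r' h0B
    · have hr' : 0 < r' := hpos.trans_le hrr
      have hmem : (r / r') • u ∈ B := by
        simp only [B, mem_closedBall_zero_iff, norm_smul] at hu ⊢
        rw [Real.norm_of_nonneg (by positivity)]
        exact mul_le_one₀ ((div_le_one hr').2 hrr) (norm_nonneg _) hu
      have := hle r' hmem
      simp only [F, smul_smul] at this ⊢
      rwa [mul_div_cancel₀ r hr'.ne'] at this
  have hmn {r : ℝ} (hr : 0 ≤ r) : 0 ≤ m r := hm0 ▸ hmono le_rfl hr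
  refine ⟨fun r => r + m r, ⟨⟨(continuous_id.add hm).continuousOn, by simp [hm0], ?_⟩, ?_⟩,
    continuous_id.add hm, fun r hr => by linarith [hmn hr], fun x => ?_⟩
  · intro r hr r' _ hrr
    exact add_lt_add_of_lt_of_le hrr (hmono hr hrr.le)
  · intro C
    refine ⟨|C| + 1, by positivity, ?_⟩
    have := hmn (r := |C| + 1) (by positivity)
    linarith [le_abs_self C]
  · have hu : ‖x‖⁻¹ • x ∈ B := by
      simp only [B, mem_closedBall_zero_iff, norm_smul, norm_inv, norm_norm]
      exact inv_mul_le_one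
    have hx : ‖x‖ • ‖x‖⁻¹ • x = x := by
      rcases eq_or_ne x 0 with rfl | h
      · simp
      · rw [smul_smul, mul_inv_cancel₀ (norm_ne_zero_iff.2 h), one_smul]
    have := hle ‖x‖ hu
    simp only [F, hx] at this
    linarith [le_abs_self (g x), norm_nonneg x]

/-- `α` restricts to an order isomorphism of `[0, ∞)`, whose inverse is automatically continuous;
clamping the argument at 0 extends it to `ℝ`. -/
theorem ClassKInf.exists_inverse {α : ℝ → ℝ} (h : ClassKInf α) :
    ∃ η : ℝ → ℝ, ClassKInf η ∧ Continuous η ∧ (∀ s, 0 ≤ s → η (α s) = s) ∧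
      ∀ s, 0 ≤ s → α (η s) = s := by
  let a : Ici (0 : ℝ) → Ici (0 : ℝ) := fun s => ⟨α s, h.nonneg s.2⟩
  have ha : StrictMono a := fun s t hst => h.strictMonoOn s.2 t.2 hst
  have hsurj : Function.Surjective a := by
    rintro ⟨y, hy⟩
    obtain ⟨c, hc0, hc⟩ := h.unbounded y
    obtain ⟨s, hs, hsy⟩ := intermediate_value_Icc hc0
      (h.continuousOn.mono Icc_subset_Ici_self) ⟨by rw [h.map_zero]; exact hy, hc.le⟩
    exact ⟨⟨s, hs.1⟩, Subtype.ext hsy⟩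
  let e := ha.orderIsoOfSurjective a hsurj
  let p : ℝ → Ici (0 : ℝ) := fun s => ⟨max s 0, mem_Ici.2 (le_max_right _ _)⟩
  have hp {s : ℝ} (hs : 0 ≤ s) : p s = ⟨s, hs⟩ := Subtype.ext (max_eq_left hs)
  let η : ℝ → ℝ := fun s => e.symm (p s)
  have hc : Continuous η :=
    continuous_subtype_val.comp (e.symm.continuous.comp (by fun_prop))
  have h1 (s : ℝ) (hs : 0 ≤ s) : η (α s) = s := by
    have : e ⟨s, hs⟩ = ⟨α s, h.nonneg hs⟩ := rfl
    simp only [η, hp (h.nonneg hs), ← this, OrderIso.symm_apply_apply]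
  have h2 (s : ℝ) (hs : 0 ≤ s) : α (η s) = s := by
    have : α (η s) = (e (e.symm (p s)) : ℝ) := rfl
    rw [this, OrderIso.apply_symm_apply, hp hs]
  refine ⟨η, ⟨⟨hc.continuousOn, ?_, ?_⟩, fun C => ?_⟩, hc, h1, h2⟩
  · simpa [h.map_zero] using h1 0 le_rfl
  · intro s hs t ht hst
    refine e.symm.strictMono ?_
    rw [hp hs, hp ht]
    exact hst
  · refine ⟨α (|C| + 1), h.nonneg (by positivity), ?_⟩
    rw [h1 _ (by positivity)]
    linarith [le_abs_self C]

theorem ClassKInf.exists_continuous_extension {α : ℝ → ℝ} (h : ClassKInf α) :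
    ∃ α' : ℝ → ℝ, ClassKInf α' ∧ Continuous α' ∧ ∀ s, 0 ≤ s → α' s = α s := by
  have heq : EqOn (fun s => α (max s 0)) α (Ici 0) := fun s hs => by
    simp only [max_eq_left (mem_Ici.1 hs)]
  refine ⟨fun s => α (max s 0), ⟨⟨?_, ?_, ?_⟩, fun C => ?_⟩, ?_, heq⟩
  · exact h.continuousOn.congr heq
  · simpa using h.map_zero
  · exact h.strictMonoOn.congr heq.symm
  · obtain ⟨s, hs, hC⟩ := h.unbounded C
    exact ⟨s, hs, by rwa [← heq hs] at hC⟩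
  · exact h.continuousOn.comp_continuous (by fun_prop) fun s => mem_Ici.2 (le_max_right _ _)

theorem ClassK.comp {α γ : ℝ → ℝ} (hα : ClassK α) (hγ : ClassK γ) : ClassK fun s => α (γ s) where
  continuousOn := hα.continuousOn.comp hγ.continuousOn fun _ hs => hγ.nonneg hs
  map_zero := by rw [hγ.map_zero, hα.map_zero]
  strictMonoOn := hα.strictMonoOn.comp hγ.strictMonoOn fun _ hs => hγ.nonneg hs

theorem ClassK.const_mul {α : ℝ → ℝ} (hα : ClassK α) {c : ℝ} (hc : 0 < c) :
    ClassK fun s => c * α s where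
  continuousOn := continuousOn_const.mul hα.continuousOn
  map_zero := by rw [hα.map_zero, mul_zero]
  strictMonoOn _ hs _ ht hst := mul_lt_mul_of_pos_left (hα.strictMonoOn hs ht hst) hc

/-- The shape of the stability estimate built from Lyapunov functions: `η` will be the inverse of
`α₁`, `γ` the flow majorant and `δ = α₂ ∘ γ`. -/
theorem classKL_exp_comp {γ η δ : ℝ → ℝ} (hγ : ClassK γ) (hη : ClassK η) (hδ : ClassK δ)
    (hγc : Continuous γ) (hηc : Continuous η) (hδc : Continuous δ) (c : ℝ) :
    ClassKL fun r s => γ (η (Real.exp (c - s) * δ r)) where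
  continuousOn := by fun_prop
  classK s _ := hγ.comp (hη.comp (hδ.const_mul (Real.exp_pos _)))
  antitoneOn r hr s _ t _ hst := by
    have h := hδ.nonneg hr
    refine hγ.mono (hη.nonneg (by positivity)) (hη.mono (by positivity) ?_)
    gcongr
  tendsto_zero r _ := by
    have h1 : Tendsto (fun s => Real.exp (c - s) * δ r) atTop (𝓝 (0 * δ r)) :=
      (Real.tendsto_exp_atBot.comp
        (tendsto_atBot_add_const_left _ c tendsto_neg_atTop_atBot)).mul_const _
    rw [zero_mul] at h1
    have h2 := ((hγc.comp hηc).tendsto 0).comp h1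
    simpa [Function.comp_def, hη.map_zero, hγ.map_zero] using h2

/-- A nonnegative monotone function that is positive on `(0, ∞)` and unbounded majorizes a
function of class `𝒦_∞`. -/
theorem exists_classKInf_minorant {θ : ℝ → ℝ} (hθ : Monotone θ) (h0 : ∀ s, 0 ≤ θ s)
    (hpos : ∀ s, 0 < s → 0 < θ s) (hunb : ∀ C, ∃ s, C ≤ θ s) :
    ∃ κ : ℝ → ℝ, ClassKInf κ ∧ ∀ s, 0 ≤ s → κ s ≤ θ s := by
  have hθint (a b : ℝ) : IntervalIntegrable θ MeasureTheory.volume a b := hθ.intervalIntegrable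
  let I (s : ℝ) : ℝ := ∫ u in (0 : ℝ)..s, θ u
  have hIc : Continuous I := intervalIntegral.continuous_primitive hθint 0
  have hI0 : I 0 = 0 := intervalIntegral.integral_same
  have hIadd (a b : ℝ) : I b = I a + ∫ u in a..b, θ u :=
    (intervalIntegral.integral_add_adjacent_intervals (hθint 0 a) (hθint a b)).symm
  have hup {a b : ℝ} (hab : a ≤ b) : ∫ u in a..b, θ u ≤ (b - a) * θ b := by
    have := intervalIntegral.integral_mono_on hab (hθint a b) (intervalIntegrable_const (c := θ b))
      fun u hu => hθ hu.2
    simpa using this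
  have hlow {a b : ℝ} (hab : a ≤ b) : (b - a) * θ a ≤ ∫ u in a..b, θ u := by
    have := intervalIntegral.integral_mono_on hab (intervalIntegrable_const (c := θ a)) (hθint a b)
      fun u hu => hθ hu.1
    simpa using this
  have hIle {s : ℝ} (hs : 0 ≤ s) : I s ≤ s * θ s := by simpa using hup hs
  have hIhalf {s : ℝ} (hs : 0 ≤ s) : s / 2 * θ (s / 2) ≤ I s := by
    have h1 := hlow (a := s / 2) (b := s) (by linarith)
    have h2 := hlow (a := 0) (b := s / 2) (by linarith)
    have h3 := hIadd (s / 2) s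
    have h4 : 0 ≤ (s / 2 - 0) * θ 0 := mul_nonneg (by linarith) (h0 0)
    have h5 : s - s / 2 = s / 2 := by ring
    rw [h5] at h1
    change _ ≤ I (s / 2) at h2
    linarith
  have hκ {s : ℝ} (hs : 0 ≤ s) : I s / (1 + s) ≤ θ s := by
    rw [div_le_iff₀ (by linarith)]
    nlinarith [hIle hs, h0 s]
  -- The primitive gives continuity. Since `I s ≤ s θ(s)`, division by `1 + s` brings it below `θ`,
  -- while strict growth survives because `I` grows at least at rate `θ(s)` beyond `s`.
  refine ⟨fun s => I s / (1 + s), ⟨⟨?_, by simp [hI0], ?_⟩, fun C => ?_⟩, fun s hs => hκ hs⟩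
  · refine hIc.continuousOn.div (by fun_prop) fun s (hs : 0 ≤ s) => ?_
    positivity
  · intro s (hs : 0 ≤ s) s' _ hss
    simp only
    rw [div_lt_div_iff₀ (by linarith) (by linarith)]
    rcases hs.eq_or_lt with rfl | hs0
    · have : 0 < s' / 2 * θ (s' / 2) := mul_pos (by linarith) (hpos _ (by linarith))
      nlinarith [hIhalf hss.le]
    · have h1 := hlow hss.le
      have h2 := hIle hs
      have h3 := hIadd s s'
      have h4 : 0 < (s' - s) * θ s := mul_pos (by linarith) (hpos s hs0)
      have h5 : I s + (s' - s) * θ s ≤ I s' := by linarith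
      have h6 := mul_le_mul_of_nonneg_right h5 (by linarith : 0 ≤ 1 + s)
      have h7 := mul_le_mul_of_nonneg_left h2 (by linarith : 0 ≤ s' - s)
      nlinarith
  -- For `s' ≥ 1` the quotient is at least `θ(s'/2) / 4`, by `hIhalf` and `1 + s' ≤ 2 s'`; hence the
  -- factor 4.
  · obtain ⟨s, hs⟩ := hunb (4 * |C| + 1)
    let s' := 2 * max s 1
    have hs1 : 1 ≤ s' / 2 := by simp [s']
    have hs2 : θ s ≤ θ (s' / 2) := hθ (by simp [s'])
    have hs' : 0 ≤ s' := by linarith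
    refine ⟨s', hs', ?_⟩
    rw [lt_div_iff₀ (by linarith)]
    have h1 := hIhalf hs'
    have h2 : (s' / 2) * (4 * |C| + 1) ≤ s' / 2 * θ (s' / 2) :=
      mul_le_mul_of_nonneg_left (hs.trans hs2) (by linarith)
    have h3 : C * (1 + s') ≤ |C| * (1 + s') :=
      mul_le_mul_of_nonneg_right (le_abs_self C) (by linarith)
    have h4 : |C| * (1 + s') ≤ |C| * (2 * s') :=
      mul_le_mul_of_nonneg_left (by linarith) (abs_nonneg C)
    nlinarith

/-- Every function of class `𝒦ℒ` decays exponentially after rescaling by a function of class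
`𝒦_∞`. -/
theorem ClassKL.exists_exp_bound {β : ℝ → ℝ → ℝ} (hβ : ClassKL β) :
    ∃ κ A : ℝ → ℝ, ClassKInf κ ∧ MonotoneOn A (Ici 0) ∧ A 0 = 0 ∧
      ∀ r t, 0 ≤ r → 0 ≤ t → κ (β r t) ≤ A r * Real.exp (-(2 * t)) := by
  -- `β(·, 0)` may be bounded; the extra term makes `b(·, 0)` unbounded, so that the sets `V s`
  -- below are nonempty.
  let b (r t : ℝ) : ℝ := β r t + r * Real.exp (-t)
  have hβ0 {r t : ℝ} (hr : 0 ≤ r) (ht : 0 ≤ t) : 0 ≤ β r t := (hβ.classK t ht).nonneg hr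
  have hb_mono {r r' t : ℝ} (hr : 0 ≤ r) (hrr : r ≤ r') (ht : 0 ≤ t) : b r t ≤ b r' t :=
    add_le_add ((hβ.classK t ht).mono hr hrr) (by gcongr)
  have hb_anti {r t t' : ℝ} (hr : 0 ≤ r) (ht : 0 ≤ t) (htt : t ≤ t') : b r t' ≤ b r t :=
    add_le_add (hβ.antitoneOn r hr ht (ht.trans htt) htt) (by gcongr)
  have hT (n : ℕ) : ∃ T : ℝ, 0 ≤ T ∧ b n T < 1 / ((n : ℝ) + 1) := by
    have h1 : Tendsto (b n) atTop (𝓝 (0 + n * 0)) :=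
      (hβ.tendsto_zero n n.cast_nonneg).add
        ((Real.tendsto_exp_neg_atTop_nhds_zero).const_mul (n : ℝ))
    have h2 : ∀ᶠ t in atTop, b n t < 1 / ((n : ℝ) + 1) :=
      h1.eventually_lt_const (by simpa using by positivity)
    obtain ⟨t, h, h'⟩ := ((eventually_ge_atTop 0).and h2).exists
    exact ⟨t, h, h'⟩
  choose T hT0 hT using hT
  let S (n : ℕ) : ℝ := ∑ k ∈ Finset.range (n + 1), T k
  have hS_mono : Monotone S := monotone_nat_of_le_succ fun n => by
    simp only [S]
    rw [Finset.sum_range_succ _ (n + 1)]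
    linarith [hT0 (n + 1)]
  have hTS (n : ℕ) : T n ≤ S n :=
    Finset.single_le_sum (fun k _ => hT0 k) (Finset.mem_range.2 n.lt_succ_self)
  have hS0 (n : ℕ) : 0 ≤ S n := (hT0 n).trans (hTS n)
  -- The exponent is chosen to cancel the part `S ⌈r⌉₊` of the time bound `htime`, leaving in `hlow`
  -- a lower bound that depends on `r` only through `r ≥ ρ`.
  let A (r : ℝ) : ℝ := r * Real.exp (2 * S ⌈r⌉₊)
  have hA_mono : MonotoneOn A (Ici 0) := fun r (hr : 0 ≤ r) r' _ hrr => by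
    have := hS_mono (Nat.ceil_mono hrr)
    simp only [A]
    gcongr
  have htime {r t s : ℝ} (hr : 0 ≤ r) (ht : 0 ≤ t) (hs : s ≤ b r t) {m : ℕ}
      (hm : 1 / ((m : ℝ) + 1) ≤ s) : t ≤ S ⌈r⌉₊ + S m := by
    by_contra! hlt
    let N := max ⌈r⌉₊ m
    have hN : S N ≤ S ⌈r⌉₊ + S m := by
      rcases le_total ⌈r⌉₊ m with h | h
      · simp only [N, max_eq_right h]
        linarith [hS0 ⌈r⌉₊]
      · simp only [N, max_eq_left h]
        linarith [hS0 m]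
    have hrN : r ≤ N := (Nat.le_ceil r).trans (Nat.cast_le.2 (le_max_left _ _))
    have h1 : b r t ≤ b N t := hb_mono hr hrN ht
    have h2 : b N t ≤ b N (T N) := hb_anti N.cast_nonneg (hT0 N) (by linarith [hTS N])
    have h3 : 1 / ((N : ℝ) + 1) ≤ 1 / ((m : ℝ) + 1) :=
      one_div_le_one_div_of_le (by positivity)
        (by gcongr; exact le_max_right _ _)
    linarith [hT N]
  -- Any `κ` below `s ↦ sInf (V s)` satisfies the claim, since `A r * e^{-2t}` belongs to `V (β r
  -- t)`. It remains to see that this infimum is positive for `s > 0` and unbounded.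
  let V (s : ℝ) : Set ℝ :=
    {v | ∃ r t, 0 ≤ r ∧ 0 ≤ t ∧ s ≤ b r t ∧ v = A r * Real.exp (-(2 * t))}
  have hA0 {r : ℝ} (hr : 0 ≤ r) : 0 ≤ A r := mul_nonneg hr (Real.exp_pos _).le
  have hV0 (s : ℝ) : ∀ v ∈ V s, 0 ≤ v := by
    rintro _ ⟨r, t, hr, -, -, rfl⟩
    exact mul_nonneg (hA0 hr) (Real.exp_pos _).le
  have hVne (s : ℝ) : (V s).Nonempty := by
    have h := hβ0 (le_max_right s 0) le_rfl
    refine ⟨_, max s 0, 0, le_max_right _ _, le_rfl, ?_, rfl⟩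
    simp only [b, neg_zero, Real.exp_zero, mul_one]
    linarith [le_max_left s 0]
  have hlow {s ρ : ℝ} {m : ℕ} (hm : 1 / ((m : ℝ) + 1) ≤ s) (hρ : 0 ≤ ρ) (hs : b ρ 0 < s) :
      ρ * Real.exp (-(2 * S m)) ≤ sInf (V s) := by
    refine le_csInf (hVne s) ?_
    rintro _ ⟨r, t, hr, ht, hb, rfl⟩
    have hρr : ρ ≤ r := by
      by_contra! hlt
      have h1 := hb_mono hr hlt.le ht
      have h2 := hb_anti hρ le_rfl ht
      linarith
    simp only [A]
    rw [mul_assoc, ← Real.exp_add]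
    gcongr
    linarith [htime hr ht hb hm]
  have hθ : Monotone fun s => sInf (V s) := fun s s' hss =>
    csInf_le_csInf ⟨0, hV0 s⟩ (hVne s') fun v ⟨r, t, hr, ht, hb, hv⟩ =>
      ⟨r, t, hr, ht, hss.trans hb, hv⟩
  have hb00 : b 0 0 = 0 := by simp [b, (hβ.classK 0 le_rfl).map_zero]
  have hpos (s : ℝ) (hs : 0 < s) : 0 < sInf (V s) := by
    obtain ⟨m, hm⟩ := exists_nat_one_div_lt hs
    have hc : ContinuousWithinAt (fun r => b r 0) (Ici 0) 0 :=
      ((hβ.classK 0 le_rfl).continuousOn.add (by fun_prop)) 0 (mem_Ici.2 le_rfl)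
    have hev : ∀ᶠ r in 𝓝[>] (0 : ℝ), b r 0 < s :=
      (hc.mono Ioi_subset_Ici_self).tendsto.eventually_lt_const (by rwa [hb00])
    obtain ⟨ρ, hρ, hρ0⟩ := (hev.and self_mem_nhdsWithin).exists
    exact (mul_pos hρ0 (Real.exp_pos _)).trans_le (hlow hm.le (le_of_lt hρ0) hρ)
  have hunb (C : ℝ) : ∃ s, C ≤ sInf (V s) := by
    let ρ := |C| * Real.exp (2 * S 0)
    have hρ : 0 ≤ ρ := by positivity
    have hb0 : 0 ≤ b ρ 0 := hb00.ge.trans (hb_mono le_rfl hρ le_rfl)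
    refine ⟨b ρ 0 + 1, le_trans ?_ (hlow (m := 0) (by simpa using hb0) hρ (by linarith))⟩
    simp only [ρ]
    rw [mul_assoc, ← Real.exp_add]
    simpa using le_abs_self C
  obtain ⟨κ, hκ, hκθ⟩ := exists_classKInf_minorant hθ
    (fun s => le_csInf (hVne s) (hV0 s)) hpos hunb
  refine ⟨κ, A, hκ, hA_mono, by simp [A], fun r t hr ht => ?_⟩
  refine (hκθ _ (hβ0 hr ht)).trans (csInf_le ⟨0, hV0 _⟩ ⟨r, t, hr, ht, ?_, rfl⟩)
  simp only [b]
  have : 0 ≤ r * Real.exp (-t) := by positivity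
  linarith

end SwitchedSystem

namespace SwitchedSystem

variable {n M : ℕ} {f : Fin M → State n → State n} {τ₁ τ₂ : ℝ}

/-! ### From Lyapunov functions to stability -/

/-- Controls the state inside a single switching interval. The sum over modes of the suprema over
`[0, τ]` is continuous and vanishes at the equilibrium, so it has a `𝒦_∞` majorant. -/
theorem exists_flow_majorant (hf : ∀ i, Regular (f i)) (τ : ℝ) :
    ∃ γ : ℝ → ℝ, ClassKInf γ ∧ Continuous γ ∧ (∀ r, 0 ≤ r → r ≤ γ r) ∧
      ∀ i, ∀ t ∈ Icc 0 τ, ∀ x, ‖flow (f i) t x‖ ≤ γ ‖x‖ := by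
  let F (i : Fin M) (x : State n) (t : ℝ) : ℝ := ‖flow (f i) |t| x‖
  have hF (i) : Continuous (Function.uncurry (F i)) :=
    ((hf i).continuous_flow_abs.comp continuous_swap).norm
  let g (x : State n) : ℝ := ∑ i, sSup (F i x '' Icc 0 τ)
  have hg : Continuous g :=
    continuous_finsetSum _ fun i _ => isCompact_Icc.continuous_sSup (hF i)
  have hg0 : g 0 = 0 := Finset.sum_eq_zero fun i _ => by
    rcases (Icc 0 τ).eq_empty_or_nonempty with h | h
    · simp [h]
    · have : F i 0 = fun _ => 0 := by
        funext t
        simp [F, (hf i).flow_apply_zero]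
      rw [this, h.image_const, csSup_singleton]
  obtain ⟨γ, hγ, hγc, hγr, hγg⟩ := exists_classKInf_majorant hg hg0
  refine ⟨γ, hγ, hγc, hγr, fun i t ht x => le_trans ?_ (hγg x)⟩
  have hle : F i x t ≤ sSup (F i x '' Icc 0 τ) :=
    le_csSup (isCompact_Icc.image ((hF i).comp (Continuous.prodMk_right x))).bddAbove
      (mem_image_of_mem _ ht)
  have hnn (j) (_ : j ∈ Finset.univ) : 0 ≤ sSup (F j x '' Icc 0 τ) :=
    Real.sSup_nonneg (by rintro _ ⟨t, -, rfl⟩; exact norm_nonneg _)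
  have hsum := Finset.single_le_sum hnn (Finset.mem_univ i)
  simp only [F, abs_of_nonneg ht.1] at hle
  exact hle.trans hsum

theorem HasLyapunovFunctions.guas (hf : ∀ i, Regular (f i))
    (h : HasLyapunovFunctions f τ₁ τ₂) : GUAS f (SdwStar M τ₁ τ₂) := by
  obtain ⟨α₁, α₂, Wm, Wp, hα₁, hα₂, -, -, hWm, -, hdwell, hswitch⟩ := h
  obtain ⟨γ, hγ, hγc, hγr, hγflow⟩ := exists_flow_majorant hf τ₂
  obtain ⟨η, hη, hηc, hηα, -⟩ := hα₁.exists_inverse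
  obtain ⟨α, hα, hαc, hαeq⟩ := hα₂.exists_continuous_extension
  -- The delay `2 * τ₂` pays for the first interval, where no decrease is available, and for the
  -- time elapsed since the last switch.
  refine ⟨_, classKL_exp_comp hγ.toClassK hη.toClassK (hα.toClassK.comp hγ.toClassK) hγc hηc
    (hαc.comp hγc) (2 * τ₂), fun σ hσ x s hs => ?_⟩
  have hφ := isSwitchedSolution_switchedFlow_of_mem_SdwStar hf hσ x
  obtain ⟨hsig, t, ht, ht1, hdw⟩ := hσ
  set φ : ℝ → State n := fun s => switchedFlow f σ s x
  change ‖φ s‖ ≤ _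
  have hlt (k : ℕ) : t k < t (k + 1) := ht.strictMono (Nat.lt_succ_self k)
  have hlen (k : ℕ) : t (k + 1) - t k ≤ τ₂ := by
    rcases k with _ | k
    · simpa [ht.zero] using ht1
    · exact (hdw (k + 1) (by omega)).2
  have hflow (k : ℕ) {u : ℝ} (hu : u ∈ Icc (t k) (t (k + 1))) :
      φ u = flow (f (σ (t k))) (u - t k) (φ (t k)) :=
    hφ.eq_flow hf (ht.nonneg k) (fun w hw => ht.eq_of_mem_Ico hsig hw) hu
  have hbound (k : ℕ) {u : ℝ} (hu : u ∈ Icc (t k) (t (k + 1))) : ‖φ u‖ ≤ γ ‖φ (t k)‖ := by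
    rw [hflow k hu]
    exact hγflow _ _ ⟨by linarith [hu.1], by linarith [hu.2, hlen k]⟩ _
  let V (k : ℕ) : ℝ := Wm (σ (t k)) (φ (t k))
  -- The interval `k = 0` is excluded: it may be shorter than `τ₁`.
  have hstep (k : ℕ) (hk : 1 ≤ k) : V (k + 1) ≤ Real.exp (-(t (k + 1) - t k)) * V k := by
    have hd := hdw k hk
    have h1 := hswitch _ _ (ht.ne_succ hsig k) (t (k + 1) - t k - τ₁)
      ⟨by linarith, by linarith⟩ (flow (f (σ (t k))) τ₁ (φ (t k)))
    rw [← (hf _).flow_add, sub_add_cancel, ← hflow k ⟨(hlt k).le, le_rfl⟩] at h1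
    refine h1.trans ?_
    have h2 := mul_le_mul_of_nonneg_left (hdwell (σ (t k)) (φ (t k)))
      (Real.exp_pos (-(t (k + 1) - t k - τ₁))).le
    rw [← mul_assoc, ← Real.exp_add] at h2
    convert h2 using 3
    ring
  have hdecay (k : ℕ) : V (k + 1) ≤ Real.exp (-(t (k + 1) - t 1)) * V 1 := by
    induction k with
    | zero => simp
    | succ k ih =>
      refine (hstep (k + 1) (by omega)).trans ?_
      have h2 := mul_le_mul_of_nonneg_left ih (Real.exp_pos (-(t (k + 1 + 1) - t (k + 1)))).le
      rw [← mul_assoc, ← Real.exp_add] at h2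
      convert h2 using 3
      ring
  have hx0 : φ (t 0) = x := by rw [ht.zero]; exact hφ.init
  have hV1 : V 1 ≤ α (γ ‖x‖) := by
    have h1 := hbound 0 (u := t 1) ⟨(hlt 0).le, le_rfl⟩
    rw [hx0] at h1
    refine (hWm _ _).2.trans ?_
    rw [← hαeq _ (norm_nonneg _)]
    exact hα.mono (norm_nonneg _) h1
  have hγx : 0 ≤ γ ‖x‖ := hγ.nonneg (norm_nonneg x)
  have hα0 : 0 ≤ α (γ ‖x‖) := hα.nonneg hγx
  have hstate (k : ℕ) (hk : t k ≤ s) (hk' : s < t (k + 1)) :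
      α₁ ‖φ (t k)‖ ≤ Real.exp (2 * τ₂ - s) * α (γ ‖x‖) := by
    have hlenk := hlen k
    rcases k with _ | k
    · rw [hx0]
      have h0 := ht.zero
      have h1 : α₁ ‖x‖ ≤ α (γ ‖x‖) := by
        refine ((hWm (σ 0) x).1.trans (hWm (σ 0) x).2).trans ?_
        rw [← hαeq _ (norm_nonneg _)]
        exact hα.mono (norm_nonneg _) (hγr _ (norm_nonneg _))
      refine h1.trans (le_mul_of_one_le_left hα0 (Real.one_le_exp ?_))
      simp only [zero_add] at hk'
      linarith
    · refine ((hWm (σ (t (k + 1))) (φ (t (k + 1)))).1.trans (hdecay k)).trans ?_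
      refine (mul_le_mul_of_nonneg_left hV1 (Real.exp_pos _).le).trans ?_
      gcongr
      linarith
  obtain ⟨k, hk⟩ := ht.exists_mem_Ico hsig hs
  refine (hbound k ⟨hk.1, hk.2.le⟩).trans (hγ.mono (norm_nonneg _) ?_)
  rw [← hηα ‖φ (t k)‖ (norm_nonneg _)]
  exact hη.mono (hα₁.nonneg (norm_nonneg _)) (hstate k hk.1 hk.2)

end SwitchedSystem

namespace SwitchedSystem

variable {n M : ℕ} {f : Fin M → State n → State n} {τ₁ τ₂ : ℝ}

/-! ### From stability to Lyapunov functions -/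

/-- The value functions are suprema over signals and unbounded times, with no compactness of the
index set; equicontinuity replaces it. -/
theorem continuous_sSup_of_equicontinuous {ι X : Type*} [TopologicalSpace X] {P : Set ι}
    (hP : P.Nonempty) {g : ι → X → ℝ} (hbdd : ∀ x, BddAbove ((fun p => g p x) '' P))
    (hg : ∀ x, ∀ ε > 0, ∀ᶠ y in 𝓝 x, ∀ p ∈ P, |g p y - g p x| ≤ ε) :
    Continuous fun x => sSup ((fun p => g p x) '' P) := by
  have hle {x y : X} {ε : ℝ} (h : ∀ p ∈ P, |g p y - g p x| ≤ ε) :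
      sSup ((fun p => g p y) '' P) ≤ sSup ((fun p => g p x) '' P) + ε := by
    refine csSup_le (hP.image _) ?_
    rintro _ ⟨p, hp, rfl⟩
    have h1 := (abs_le.1 (h p hp)).2
    have h2 : g p x ≤ sSup ((fun p => g p x) '' P) := le_csSup (hbdd x) ⟨p, hp, rfl⟩
    simp only
    linarith
  refine continuous_iff_continuousAt.2 fun x => Metric.tendsto_nhds.2 fun ε hε => ?_
  filter_upwards [hg x (ε / 2) (half_pos hε)] with y hy
  have h1 := hle hy
  have h2 := hle (x := y) (y := x) (ε := ε / 2) fun p hp => by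
    rw [abs_sub_comm]
    exact hy p hp
  rw [Real.dist_eq, abs_lt]
  constructor <;> linarith

/-- Under a uniform exponential bound, the weighted trajectories are equicontinuous in the initial
state, uniformly in the signal and in time. -/
theorem eventually_abs_exp_mul_sub_le (hf : ∀ i, Regular (f i)) {S : Set (ℝ → Fin M)}
    {β : ℝ → ℝ → ℝ} (hβ : ClassKL β) {κ A : ℝ → ℝ} (hκ : ClassK κ)
    (hκA : ∀ r t, 0 ≤ r → 0 ≤ t → κ (β r t) ≤ A r * Real.exp (-(2 * t)))
    (hsol : ∀ σ ∈ S, ∀ x, IsSwitchedSolution f σ x fun s => switchedFlow f σ s x)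
    (hS : ∀ σ ∈ S, ∀ x : State n, ∀ t, 0 ≤ t → ‖switchedFlow f σ t x‖ ≤ β ‖x‖ t)
    (x : State n) {ε : ℝ} (hε : 0 < ε) :
    ∀ᶠ y in 𝓝 x, ∀ σ ∈ S, ∀ t, 0 ≤ t →
      |Real.exp t * κ ‖switchedFlow f σ t y‖ - Real.exp t * κ ‖switchedFlow f σ t x‖| ≤ ε := by
  let R := ‖x‖ + 1
  have hR : 0 ≤ R := by positivity
  have hxR : ‖x‖ ≤ R := by simp [R]
  have hlim : Tendsto (fun t => A R * Real.exp (-t)) atTop (𝓝 (A R * 0)) :=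
    Real.tendsto_exp_neg_atTop_nhds_zero.const_mul _
  rw [mul_zero] at hlim
  -- After `T` the spare factor `e^{-t}` left by the rate 2 puts both terms in `[0, ε]`. Before `T`,
  -- Grönwall applies uniformly in the signal, since all trajectories stay in the ball of radius `β
  -- R 0`.
  obtain ⟨T, hT⟩ := eventually_atTop.1 (hlim.eventually_le_const hε)
  obtain ⟨L, hL⟩ := exists_common_lipschitzOnWith (fun i => (hf i).locallyLipschitz)
    (isCompact_closedBall (0 : State n) (β R 0))
  have huc : UniformContinuousOn κ (Icc 0 (β R 0)) :=
    isCompact_Icc.uniformContinuousOn_of_continuous (hκ.continuousOn.mono Icc_subset_Ici_self)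
  obtain ⟨δ, hδ, hκδ⟩ := Metric.uniformContinuousOn_iff.1 huc (ε / Real.exp T) (by positivity)
  have hbd {y : State n} (hy : ‖y‖ ≤ R) {σ} (hσ : σ ∈ S) {t : ℝ} (ht : 0 ≤ t) :
      ‖switchedFlow f σ t y‖ ≤ β R t :=
    (hS σ hσ y t ht).trans ((hβ.classK t ht).mono (norm_nonneg y) hy)
  have hbd0 {y : State n} (hy : ‖y‖ ≤ R) {σ} (hσ : σ ∈ S) {t : ℝ} (ht : 0 ≤ t) :
      ‖switchedFlow f σ t y‖ ≤ β R 0 :=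
    (hbd hy hσ ht).trans (hβ.antitoneOn R hR (mem_Ici.2 le_rfl) ht ht)
  have htail {y : State n} (hy : ‖y‖ ≤ R) {σ} (hσ : σ ∈ S) {t : ℝ} (ht : 0 ≤ t) (htT : T ≤ t) :
      Real.exp t * κ ‖switchedFlow f σ t y‖ ∈ Icc 0 ε := by
    refine ⟨mul_nonneg (Real.exp_pos t).le (hκ.nonneg (norm_nonneg _)), ?_⟩
    have h1 := (hκ.mono (norm_nonneg _) (hbd hy hσ ht)).trans (hκA R t hR ht)
    refine (mul_le_mul_of_nonneg_left h1 (Real.exp_pos t).le).trans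
      (le_trans (le_of_eq ?_) (hT t htT))
    rw [mul_left_comm, ← Real.exp_add]
    congr 2
    ring
  have e1 : ∀ᶠ y in 𝓝 x, dist y x < 1 := Metric.ball_mem_nhds x one_pos
  have e2 : ∀ᶠ y in 𝓝 x, dist y x * Real.exp (L * T) < δ :=
    ((continuous_id.dist continuous_const).mul continuous_const).continuousAt.eventually_lt
      continuousAt_const (by simpa)
  filter_upwards [e1, e2] with y h1 h2 σ hσ t ht
  have hyR : ‖y‖ ≤ R := by
    have := norm_le_norm_add_norm_sub' y x
    rw [dist_eq_norm] at h1
    simp only [R]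
    linarith
  rcases le_total T t with htT | htT
  · have hy := htail hyR hσ ht htT
    have hx := htail hxR hσ ht htT
    rw [abs_le]
    constructor <;> linarith [hx.1, hx.2, hy.1, hy.2]
  · have hd := (hsol σ hσ y).dist_le (hsol σ hσ x) hL
      (fun s hs => mem_closedBall_zero_iff.2 (hbd0 hyR hσ hs))
      (fun s hs => mem_closedBall_zero_iff.2 (hbd0 hxR hσ hs)) ht
    have hd' : dist ‖switchedFlow f σ t y‖ ‖switchedFlow f σ t x‖ < δ := by
      refine ((dist_norm_norm_le _ _).trans ?_).trans_lt h2
      rw [← dist_eq_norm]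
      refine hd.trans ?_
      gcongr
    have hk := (hκδ _ ⟨norm_nonneg _, hbd0 hyR hσ ht⟩ _ ⟨norm_nonneg _, hbd0 hxR hσ ht⟩ hd').le
    rw [Real.dist_eq] at hk
    rw [← mul_sub, abs_mul, abs_of_pos (Real.exp_pos t)]
    calc Real.exp t * _ ≤ Real.exp T * (ε / Real.exp T) := by gcongr
      _ = ε := mul_div_cancel₀ _ (Real.exp_ne_zero T)

/-- The switching inequality is vacuous, so `W⁺` can be the norm and the second term of `W⁻` is
there to give the dwell inequality. -/
theorem HasLyapunovFunctions.of_subsingleton (hf : ∀ i, Regular (f i)) (hτ₁ : 0 ≤ τ₁)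
    [Subsingleton (Fin M)] : HasLyapunovFunctions f τ₁ τ₂ := by
  let Wm (i : Fin M) (x : State n) : ℝ := ‖x‖ + Real.exp τ₁ * ‖flow (f i) τ₁ x‖
  have hWm (i) : Continuous (Wm i) :=
    continuous_norm.add (continuous_const.mul ((hf i).continuous_flow_space hτ₁).norm)
  obtain ⟨α, hα, -, hαr, hαW⟩ := exists_classKInf_majorant (g := fun x => ∑ i, Wm i x)
    (continuous_finsetSum _ fun i _ => hWm i) (by simp [Wm, (hf _).flow_apply_zero])
  refine ⟨fun s => s, α, Wm, fun _ x => ‖x‖, ClassKInf.id, hα, hWm, fun _ => continuous_norm,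
    fun i x => ⟨?_, ?_⟩, fun i x => ⟨le_rfl, hαr _ (norm_nonneg x)⟩, fun i x => ?_,
    fun i j hij => absurd (Subsingleton.elim i j) hij⟩
  · exact le_add_of_nonneg_right (by positivity)
  · exact (Finset.single_le_sum (f := fun i => Wm i x) (fun j _ => by positivity)
      (Finset.mem_univ i)).trans (hαW x)
  · simp only [Wm, mul_add, ← mul_assoc, ← Real.exp_add]
    simp only [neg_add_cancel, Real.exp_zero, one_mul]
    exact le_add_of_nonneg_left (by positivity)

/-- Only flows over time 0 occur, so the norm serves for all modes. -/
theorem HasLyapunovFunctions.of_zero (hf : ∀ i, Regular (f i)) :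
    HasLyapunovFunctions f 0 0 := by
  refine ⟨fun s => s, fun s => s, fun _ x => ‖x‖, fun _ x => ‖x‖, ClassKInf.id, ClassKInf.id,
    fun _ => continuous_norm, fun _ => continuous_norm, fun i x => ⟨le_rfl, le_rfl⟩,
    fun i x => ⟨le_rfl, le_rfl⟩, fun i x => ?_, fun i j _ t ht x => ?_⟩
  · simp [(hf i).flow_zero]
  · obtain rfl : t = 0 := by simpa using ht
    simp [(hf i).flow_zero]

/-- The value functions `sup e^t κ(‖Φ_σ(t, x)‖)` over the signals with first mode `i`. -/
theorem GUAS.exists_valueFunctions (hf : ∀ i, Regular (f i)) [Nontrivial (Fin M)]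
    (hτ₁ : 0 ≤ τ₁) (hτ : τ₁ ≤ τ₂) (hτ₂ : 0 < τ₂) (h : GUAS f (Sdw M τ₁ τ₂)) :
    ∃ (κ : ℝ → ℝ) (W : Fin M → State n → ℝ), ClassKInf κ ∧ (∀ i, Continuous (W i)) ∧
      (∀ i x, κ ‖x‖ ≤ W i x) ∧ (∀ i, W i 0 = 0) ∧
      ∀ i j, i ≠ j → ∀ a, τ₁ ≤ a → a ≤ τ₂ → ∀ x,
        W j (flow (f i) a x) ≤ Real.exp (-a) * W i x := by
  obtain ⟨β, hβ, hS⟩ := h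
  obtain ⟨κ, A, hκ, hA, hA0, hκA⟩ := hβ.exists_exp_bound
  have hsol : ∀ σ ∈ Sdw M τ₁ τ₂, ∀ x, IsSwitchedSolution f σ x fun s => switchedFlow f σ s x :=
    fun σ hσ x => isSwitchedSolution_switchedFlow_of_mem_SdwStar hf (Sdw_subset_SdwStar _ _ _ hσ) x
  let P (i : Fin M) : Set ((ℝ → Fin M) × ℝ) :=
    {p | p.1 ∈ Sdw M τ₁ τ₂ ∧ p.1 0 = i ∧ 0 ≤ p.2}
  have hP (i) : ∃ σ, (σ, (0 : ℝ)) ∈ P i := by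
    obtain ⟨j, hj⟩ := exists_ne i
    exact ⟨_, alternating_mem_Sdw hj.symm hτ hτ₂, alternating_zero i j τ₂, le_rfl⟩
  have hPne (i) : (P i).Nonempty :=
    let ⟨_, h⟩ := hP i
    ⟨_, h⟩
  let g (p : (ℝ → Fin M) × ℝ) (x : State n) : ℝ :=
    Real.exp p.2 * κ ‖switchedFlow f p.1 p.2 x‖
  have hg_le (i) (p) (hp : p ∈ P i) (x : State n) : g p x ≤ A ‖x‖ := by
    have hx := norm_nonneg x
    have h1 := (hκ.mono (norm_nonneg _) (hS p.1 hp.1 x p.2 hp.2.2)).trans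
      (hκA _ p.2 hx hp.2.2)
    have h2 : 0 ≤ A ‖x‖ := hA0 ▸ hA (mem_Ici.2 le_rfl) hx hx
    calc g p x ≤ Real.exp p.2 * (A ‖x‖ * Real.exp (-(2 * p.2))) := by
          simp only [g]
          gcongr
      _ = A ‖x‖ * Real.exp (-p.2) := by
          rw [mul_left_comm, ← Real.exp_add]
          congr 2
          ring
      _ ≤ A ‖x‖ := mul_le_of_le_one_right h2 (Real.exp_le_one_iff.2 (by linarith [hp.2.2]))
  have hbdd (i) (x : State n) : BddAbove ((fun p => g p x) '' P i) :=
    ⟨A ‖x‖, by rintro _ ⟨p, hp, rfl⟩; exact hg_le i p hp x⟩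
  let Wm (i : Fin M) (x : State n) : ℝ := sSup ((fun p => g p x) '' P i)
  have hWm_cont (i) : Continuous (Wm i) := by
    refine continuous_sSup_of_equicontinuous (hPne i) (hbdd i) fun x ε hε => ?_
    filter_upwards [eventually_abs_exp_mul_sub_le hf hβ hκ.toClassK hκA hsol hS x hε]
      with y hy p hp using hy p.1 hp.1 p.2 hp.2.2
  have hWm_ge (i) (x : State n) : κ ‖x‖ ≤ Wm i x := by
    obtain ⟨σ, hσ⟩ := hP i
    refine le_csSup (hbdd i x) ⟨_, hσ, ?_⟩
    have : switchedFlow f σ 0 x = x := (hsol σ hσ.1 x).init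
    simp [g, this]
  have hWm_nonneg (i) (x : State n) : 0 ≤ Wm i x :=
    (hκ.nonneg (norm_nonneg x)).trans (hWm_ge i x)
  have hWm_zero (i) : Wm i 0 = 0 := by
    refine le_antisymm (csSup_le ((hPne i).image _) ?_) (hWm_nonneg i 0)
    rintro _ ⟨p, hp, rfl⟩
    simpa [hA0] using hg_le i p hp 0
  -- Each competitor `(σ, t)` for `W j` at `Φ_i(a, x)` yields the competitor `(prepend i a σ, t +
  -- a)` for `W i` at `x`, whose weight is larger by `e^a`.
  have hconcat_pos {i j : Fin M} (hij : i ≠ j) {a : ℝ} (ha : 0 < a) (h₁ : τ₁ ≤ a) (h₂ : a ≤ τ₂)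
      (x : State n) : Wm j (flow (f i) a x) ≤ Real.exp (-a) * Wm i x := by
    refine csSup_le ((hPne j).image _) ?_
    rintro _ ⟨⟨σ, t⟩, ⟨hσ, hσ0, ht⟩, rfl⟩
    simp only at hσ hσ0 ht
    have hi : σ 0 ≠ i := hσ0 ▸ hij.symm
    have hmem : (prepend i a σ, t + a) ∈ P i :=
      ⟨prepend_mem_Sdw hσ ha h₁ h₂ hi, prepend_of_lt ha, by simp only; linarith⟩
    have h1 : g (prepend i a σ, t + a) x ≤ Wm i x := le_csSup (hbdd i x) ⟨_, hmem, rfl⟩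
    have h2 : g (σ, t) (flow (f i) a x) = Real.exp (-a) * g (prepend i a σ, t + a) x := by
      simp only [g, switchedFlow_prepend hf hσ ha h₁ h₂ hi x ht, ← mul_assoc, ← Real.exp_add]
      congr 2
      ring
    simp only [h2]
    gcongr
  refine ⟨κ, Wm, hκ, hWm_cont, hWm_ge, hWm_zero, fun i j hij a h₁ h₂ x => ?_⟩
  -- For `a = 0` the prepended signal would not start in mode `i`; the inequality is obtained as the
  -- limit `a → 0⁺`, using continuity of `W j`.
  rcases (hτ₁.trans h₁).eq_or_lt with rfl | ha
  · have hl : Tendsto (fun a => Wm j (flow (f i) a x)) (𝓝[>] 0) (𝓝 (Wm j (flow (f i) 0 x))) :=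
      (((hWm_cont j).comp ((hf i).continuous_flow_time x)).tendsto 0).mono_left
        nhdsWithin_le_nhds
    have hr : Tendsto (fun a => Real.exp (-a) * Wm i x) (𝓝[>] 0)
        (𝓝 (Real.exp (-0) * Wm i x)) :=
      ((by fun_prop : Continuous fun a => Real.exp (-a) * Wm i x).tendsto 0).mono_left
        nhdsWithin_le_nhds
    refine le_of_tendsto_of_tendsto hl hr ?_
    filter_upwards [Ioo_mem_nhdsGT hτ₂] with a ha
    exact hconcat_pos hij ha.1 (h₁.trans ha.1.le) ha.2.le x
  · exact hconcat_pos hij ha h₁ h₂ x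

theorem GUAS.hasLyapunovFunctions_of_nontrivial (hf : ∀ i, Regular (f i)) [Nontrivial (Fin M)]
    (hτ₁ : 0 ≤ τ₁) (hτ : τ₁ ≤ τ₂) (hτ₂ : 0 < τ₂) (h : GUAS f (Sdw M τ₁ τ₂)) :
    HasLyapunovFunctions f τ₁ τ₂ := by
  obtain ⟨κ, Wm, hκ, hWm_cont, hWm_ge, hWm_zero, hconcat⟩ :=
    h.exists_valueFunctions hf hτ₁ hτ hτ₂
  have hWm_nonneg (i) (x : State n) : 0 ≤ Wm i x :=
    (hκ.nonneg (norm_nonneg x)).trans (hWm_ge i x)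
  let G (i : Fin M) (x : State n) (q : Fin M × ℝ) : ℝ :=
    Real.exp q.2 * Wm q.1 (flow (f i) |q.2| x)
  have hG (i) : Continuous (Function.uncurry (G i)) := by
    have h1 : Continuous fun w : Fin M × State n => Wm w.1 w.2 :=
      continuous_prod_of_discrete_left.2 hWm_cont
    have h2 : Continuous fun z : State n × (Fin M × ℝ) => flow (f i) |z.2.2| z.1 :=
      (hf i).continuous_flow_abs.comp
        (by fun_prop : Continuous fun z : State n × (Fin M × ℝ) => (z.2.2, z.1))
    exact (Real.continuous_exp.comp (continuous_snd.comp continuous_snd)).mul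
      (h1.comp ((continuous_fst.comp continuous_snd).prodMk h2))
  let K (i : Fin M) : Set (Fin M × ℝ) := {j | j ≠ i} ×ˢ Icc 0 (τ₂ - τ₁)
  have hK (i) : IsCompact (K i) := (toFinite _).isCompact.prod isCompact_Icc
  have hKne (i) : (K i).Nonempty := by
    obtain ⟨j, hj⟩ := exists_ne i
    exact ⟨(j, 0), hj, le_rfl, sub_nonneg.2 hτ⟩
  -- The smallest function compatible with the switching inequality; compactness of `K i` makes it
  -- continuous.
  let Wp (i : Fin M) (x : State n) : ℝ := sSup (G i x '' K i)
  have hWp_cont (i) : Continuous (Wp i) := (hK i).continuous_sSup (hG i)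
  have hG_le (i) (x : State n) {q} (hq : q ∈ K i) : G i x q ≤ Wp i x :=
    le_csSup ((hK i).image ((hG i).comp (Continuous.prodMk_right x))).bddAbove ⟨q, hq, rfl⟩
  have hWp_ge (i) (x : State n) : κ ‖x‖ ≤ Wp i x := by
    obtain ⟨j, hj⟩ := exists_ne i
    refine le_trans ?_ (hG_le i x (q := (j, 0)) ⟨hj, le_rfl, sub_nonneg.2 hτ⟩)
    simpa [G, (hf i).flow_zero] using hWm_ge j x
  have hWp_nonneg (i) (x : State n) : 0 ≤ Wp i x :=
    (hκ.nonneg (norm_nonneg x)).trans (hWp_ge i x)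
  have hWp_zero (i) : Wp i 0 = 0 := by
    refine le_antisymm (csSup_le ((hKne i).image _) ?_) (hWp_nonneg i 0)
    rintro _ ⟨q, -, rfl⟩
    simp [G, (hf i).flow_apply_zero, hWm_zero]
  obtain ⟨α, hα, -, -, hαW⟩ := exists_classKInf_majorant (g := fun x => ∑ i, (Wm i x + Wp i x))
    (continuous_finsetSum _ fun i _ => (hWm_cont i).add (hWp_cont i))
    (by simp [hWm_zero, hWp_zero])
  have hup (i) (x : State n) : Wm i x + Wp i x ≤ α ‖x‖ :=
    (Finset.single_le_sum (f := fun i => Wm i x + Wp i x)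
      (fun j _ => add_nonneg (hWm_nonneg j x) (hWp_nonneg j x)) (Finset.mem_univ i)).trans (hαW x)
  refine ⟨κ, α, Wm, Wp, hκ, hα, hWm_cont, hWp_cont,
    fun i x => ⟨hWm_ge i x, by linarith [hup i x, hWp_nonneg i x]⟩,
    fun i x => ⟨hWp_ge i x, by linarith [hup i x, hWm_nonneg i x]⟩, fun i x => ?_,
    fun i j hij t ht x => ?_⟩
  · refine csSup_le ((hKne i).image _) ?_
    rintro _ ⟨⟨j, s⟩, ⟨hj, hs0, hs⟩, rfl⟩
    simp only at hj hs0 hs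
    simp only [G, abs_of_nonneg hs0, ← (hf i).flow_add]
    -- The total time `s + τ₁` lies in `[τ₁, τ₂]`, and `e^s * e^{-(s+τ₁)} = e^{-τ₁}`.
    have h1 := hconcat i j (Ne.symm hj) (s + τ₁) (by linarith) (by linarith) x
    refine (mul_le_mul_of_nonneg_left h1 (Real.exp_pos s).le).trans (le_of_eq ?_)
    rw [← mul_assoc, ← Real.exp_add]
    congr 2
    ring
  · have h1 := hG_le i x (q := (j, t)) ⟨hij.symm, ht⟩
    simp only [G, abs_of_nonneg ht.1] at h1
    rw [Real.exp_neg, ← div_eq_inv_mul, le_div_iff₀ (Real.exp_pos t), mul_comm]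
    exact h1

theorem GUAS.hasLyapunovFunctions (hf : ∀ i, Regular (f i)) (hτ₁ : 0 ≤ τ₁) (hτ : τ₁ ≤ τ₂)
    (h : GUAS f (Sdw M τ₁ τ₂)) : HasLyapunovFunctions f τ₁ τ₂ := by
  rcases subsingleton_or_nontrivial (Fin M) with _ | _
  · exact .of_subsingleton hf hτ₁
  · rcases (hτ₁.trans hτ).eq_or_lt with rfl | hτ₂
    · obtain rfl := le_antisymm hτ hτ₁
      exact .of_zero hf
    · exact h.hasLyapunovFunctions_of_nontrivial hf hτ₁ hτ hτ₂

theorem GUAS.mono {S S' : Set (ℝ → Fin M)} (hS : S ⊆ S') (h : GUAS f S') : GUAS f S := by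
  obtain ⟨β, hβ, h⟩ := h
  exact ⟨β, hβ, fun σ hσ => h σ (hS hσ)⟩

end SwitchedSystem

theorem proposition2 {n M : ℕ}
    (f : Fin M → SwitchedSystem.State n → SwitchedSystem.State n)
    (hf : ∀ i, SwitchedSystem.Regular (f i))
    (τ₁ τ₂ : ℝ) (hτ₁ : 0 ≤ τ₁) (hτ₂ : τ₁ ≤ τ₂) :
    (SwitchedSystem.GUAS f (SwitchedSystem.SdwStar M τ₁ τ₂) ↔
      SwitchedSystem.HasLyapunovFunctions f τ₁ τ₂) ∧
    (SwitchedSystem.GUAS f (SwitchedSystem.Sdw M τ₁ τ₂) ↔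
      SwitchedSystem.HasLyapunovFunctions f τ₁ τ₂) := by
  have hsub := SwitchedSystem.Sdw_subset_SdwStar M τ₁ τ₂
  exact ⟨⟨fun h => (h.mono hsub).hasLyapunovFunctions hf hτ₁ hτ₂, fun h => h.guas hf⟩,
    fun h => h.hasLyapunovFunctions hf hτ₁ hτ₂, fun h => (h.guas hf).mono hsub⟩
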